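/- Let $L^2(\mathbb{R})$ be the complex Hilbert space of square-integrable functions on $\mathbb{R}$ with Lebesgue measure, and regard $L^2(\mathbb{R}_+)$ as the closed subspace of those $f\in L^2(\mathbb{R})$ that vanish a.e. on $(-\infty,0)$. Let $\mathcal{C}$ be the Cesàro operator $$(\mathcal{C}f)(x)=\frac1x\int_0^x f(t)\,dt=\int_0^1 f(ux)\,du$$ and, for $\alpha\in\mathbb{C}$ with $\mathrm{Re}(\alpha)>0$, let $H_\alpha$ be the Hölder mean $$(H_\alpha f)(x)=\frac1{\Gamma(\alpha)}\int_0^1\Bigl(\log\frac1u\Bigr)^{\alpha-1}f(ux)\,du .$$ Both are bounded operators in $L^2(\mathbb{R})$ that leave $L^2(\mathbb{R}_+)$ invariant; let $\mathcal{C}_+$ and $H_{\alpha+}$ be their restrictions to $L^2(\mathbb{R}_+)$. Then $\mathcal{C}_+$ is normal and its spectrum is contained in $\{z:\mathrm{Re}(z)>0\}\cup\{0\}$. For every $\alpha\in\mathbb{C}$ with $\mathrm{Re}(\alpha)>0$, the branch of $z^\alpha$ on $\{\mathrm{Re}(z)>0\}$ with $1^\alpha=1$, extended by $0^\alpha:=0$,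 is continuous on the spectrum of $\mathcal{C}_+$, and the fractional power $(\mathcal{C}_+)^\alpha$, defined by the continuous functional calculus for normal operators, satisfies $$(\mathcal{C}_+)^\alpha=H_{\alpha+}.$$ In particular, for every integer $n\ge 1$ the $n$-th iterate of $\mathcal{C}_+$ equals $H_{n+}$ (Boyd's formula). -/

import Mathlib

open MeasureTheory

noncomputable section

/-- The complex Hilbert space `L²(ℝ)` (Lebesgue measure). -/
abbrev L2R : Type := Lp ℂ 2 (volume : Measure ℝ)

/-- Admissible kernels of one-dimensional Hausdorff operators `f ↦ ∫ K(u) f(ux) du`: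
`K` is measurable and `K(u) |u|^(-1/2)` belongs to `L¹(ℝ)`. -/
structure IsHausdorffKernel (K : ℝ → ℂ) : Prop where
  measurable : Measurable K
  integrable : Integrable (fun u : ℝ => K u * ((|u| ^ (-(1 / 2) : ℝ) : ℝ) : ℂ))

namespace Hausdorff

open scoped ENNReal

/-- The function `x ↦ ∫ K(u) f(ux) du`. -/
def fn (K f : ℝ → ℂ) (x : ℝ) : ℂ := ∫ u : ℝ, K u * f (u * x)

/-- The `L¹`-norm of `K(u) |u|^(-1/2)`, as an extended nonnegative number. -/
def wt (K : ℝ → ℂ) : ℝ≥0∞ := ∫⁻ u : ℝ, ‖K u * ((|u| ^ (-(1 / 2) : ℝ) : ℝ) : ℂ)‖ₑ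

theorem wt_lt_top {K : ℝ → ℂ} (hK : IsHausdorffKernel K) : wt K < ∞ :=
  hK.integrable.2

theorem lintegral_dilate (f : ℝ → ℝ≥0∞) (hf : Measurable f) {u : ℝ} (hu : u ≠ 0) :
    ∫⁻ x, f (u * x) = ENNReal.ofReal |u|⁻¹ * ∫⁻ x, f x := by
  rw [← lintegral_map hf (measurable_const_mul u), Real.map_volume_mul_left hu,
    lintegral_smul_measure, abs_inv, smul_eq_mul]

/-- Pointwise Cauchy–Schwarz estimate. -/
theorem sq_le {K f : ℝ → ℂ} (hK : Measurable K) (hf : Measurable f) (x : ℝ) :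
    (∫⁻ u : ℝ, ‖K u * f (u * x)‖ₑ) ^ (2 : ℝ) ≤
      wt K * ∫⁻ u : ℝ, ‖K u‖ₑ * ENNReal.ofReal (|u| ^ (1 / 2 : ℝ)) * ‖f (u * x)‖ₑ ^ (2 : ℝ) := by
  have hfx : Measurable fun u : ℝ => f (u * x) := hf.comp (measurable_mul_const x)
  have hw : Measurable fun u : ℝ => |u| ^ (-(1 / 2) : ℝ) := by fun_prop
  have hw' : Measurable fun u : ℝ => |u| ^ (1 / 2 : ℝ) := by fun_prop
  set F : ℝ → ℝ≥0∞ := fun u => ‖K u * ((|u| ^ (-(1 / 2) : ℝ) : ℝ) : ℂ)‖ₑ with hF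
  set G : ℝ → ℝ≥0∞ :=
    fun u => ‖K u‖ₑ * ENNReal.ofReal (|u| ^ (1 / 2 : ℝ)) * ‖f (u * x)‖ₑ ^ (2 : ℝ) with hG
  have hFm : Measurable F := by
    simp only [hF]; fun_prop
  have hGm : Measurable G := by
    simp only [hG]; fun_prop
  have h0 : ∀ᵐ u : ℝ, u ≠ 0 := by
    simp [ae_iff]
  have key : (∫⁻ u : ℝ, ‖K u * f (u * x)‖ₑ) = ∫⁻ u, F u ^ (1 / 2 : ℝ) * G u ^ (1 / 2 : ℝ) := by
    refine lintegral_congr_ae (h0.mono fun u hu => ?_)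
    have hup : 0 < |u| := abs_pos.mpr hu
    have e1 : ‖((|u| ^ (-(1 / 2) : ℝ) : ℝ) : ℂ)‖ₑ = ENNReal.ofReal (|u| ^ (-(1 / 2) : ℝ)) := by
      rw [← ofReal_norm, Complex.norm_real, Real.norm_of_nonneg (by positivity)]
    have e2 : ENNReal.ofReal (|u| ^ (-(1 / 2) : ℝ)) * ENNReal.ofReal (|u| ^ (1 / 2 : ℝ)) = 1 := by
      rw [← ENNReal.ofReal_mul (by positivity), ← Real.rpow_add hup]; simp
    have e3 : F u * G u = (‖K u * f (u * x)‖ₑ) ^ (2 : ℝ) := by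
      simp only [hF, hG, enorm_mul, e1]
      calc _ = ‖K u‖ₑ * ‖K u‖ₑ * ‖f (u * x)‖ₑ ^ (2 : ℝ) *
            (ENNReal.ofReal (|u| ^ (-(1 / 2) : ℝ)) * ENNReal.ofReal (|u| ^ (1 / 2 : ℝ))) := by
              ring
        _ = _ := by
              rw [e2, ENNReal.mul_rpow_of_nonneg _ _ (by norm_num), mul_one]
              simp only [ENNReal.rpow_ofNat]; ring
    change _ = F u ^ (1 / 2 : ℝ) * G u ^ (1 / 2 : ℝ)
    rw [← ENNReal.mul_rpow_of_nonneg _ _ (by norm_num), e3, ← ENNReal.rpow_mul]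
    norm_num
  have hol := ENNReal.lintegral_mul_le_Lp_mul_Lq volume Real.HolderConjugate.two_two
    (hFm.pow_const (1 / 2 : ℝ)).aemeasurable (hGm.pow_const (1 / 2 : ℝ)).aemeasurable
  have hs : ∀ t : ℝ≥0∞, (t ^ (1 / 2 : ℝ)) ^ (2 : ℝ) = t := fun t => by
    rw [← ENNReal.rpow_mul]; norm_num
  simp only [hs] at hol
  calc (∫⁻ u : ℝ, ‖K u * f (u * x)‖ₑ) ^ (2 : ℝ)
      ≤ ((∫⁻ u, F u) ^ (1 / 2 : ℝ) * (∫⁻ u, G u) ^ (1 / 2 : ℝ)) ^ (2 : ℝ) := by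
        rw [key]
        exact ENNReal.rpow_le_rpow hol (by norm_num)
    _ = _ := by
        rw [ENNReal.mul_rpow_of_nonneg _ _ (by norm_num), hs, hs]; rfl

theorem lintegral_sq_le {K f : ℝ → ℂ} (hK : Measurable K) (hf : Measurable f) :
    ∫⁻ x : ℝ, (∫⁻ u : ℝ, ‖K u * f (u * x)‖ₑ) ^ (2 : ℝ) ≤
      wt K ^ (2 : ℝ) * ∫⁻ x : ℝ, ‖f x‖ₑ ^ (2 : ℝ) := by
  have hm : Measurable fun p : ℝ × ℝ =>
      ‖K p.2‖ₑ * ENNReal.ofReal (|p.2| ^ (1 / 2 : ℝ)) * ‖f (p.2 * p.1)‖ₑ ^ (2 : ℝ) := by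
    fun_prop
  have h0 : ∀ᵐ u : ℝ, u ≠ 0 := by
    simp [ae_iff]
  calc _ ≤ ∫⁻ x : ℝ, wt K * ∫⁻ u : ℝ,
          ‖K u‖ₑ * ENNReal.ofReal (|u| ^ (1 / 2 : ℝ)) * ‖f (u * x)‖ₑ ^ (2 : ℝ) :=
        lintegral_mono fun x => sq_le hK hf x
    _ = wt K * ∫⁻ x : ℝ, ∫⁻ u : ℝ,
          ‖K u‖ₑ * ENNReal.ofReal (|u| ^ (1 / 2 : ℝ)) * ‖f (u * x)‖ₑ ^ (2 : ℝ) :=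
        lintegral_const_mul _ hm.lintegral_prod_right'
    _ = wt K * ∫⁻ u : ℝ, ∫⁻ x : ℝ,
          ‖K u‖ₑ * ENNReal.ofReal (|u| ^ (1 / 2 : ℝ)) * ‖f (u * x)‖ₑ ^ (2 : ℝ) := by
        rw [lintegral_lintegral_swap hm.aemeasurable]
    _ = wt K * ∫⁻ u : ℝ, ‖K u * ((|u| ^ (-(1 / 2) : ℝ) : ℝ) : ℂ)‖ₑ *
          ∫⁻ x : ℝ, ‖f x‖ₑ ^ (2 : ℝ) := by
        congr 1
        refine lintegral_congr_ae (h0.mono fun u hu => ?_)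
        have hup : 0 < |u| := abs_pos.mpr hu
        have hfu : Measurable fun x : ℝ => ‖f (u * x)‖ₑ ^ (2 : ℝ) := by fun_prop
        have e1 : ‖((|u| ^ (-(1 / 2) : ℝ) : ℝ) : ℂ)‖ₑ =
            ENNReal.ofReal (|u| ^ (1 / 2 : ℝ)) * ENNReal.ofReal |u|⁻¹ := by
          rw [← ofReal_norm, Complex.norm_real, Real.norm_of_nonneg (by positivity),
            ← ENNReal.ofReal_mul (by positivity), ← Real.rpow_neg_one, ← Real.rpow_add hup]
          norm_num
        simp only []
        rw [lintegral_const_mul _ hfu,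
          lintegral_dilate (fun x => ‖f x‖ₑ ^ (2 : ℝ)) (by fun_prop) hu, enorm_mul, e1]
        ring
    _ = _ := by
        rw [lintegral_mul_const _ (by have := hK; fun_prop)]
        simp only [ENNReal.rpow_ofNat, wt]; ring

theorem lintegral_sq_lt_top (f : L2R) : ∫⁻ x : ℝ, ‖f x‖ₑ ^ (2 : ℝ) < ∞ := by
  simpa using lintegral_rpow_enorm_lt_top_of_eLpNorm_lt_top (p := 2) (by norm_num) (by norm_num)
    (Lp.memLp f).2

theorem measurable_inner {K : ℝ → ℂ} (hK : Measurable K) {f : ℝ → ℂ} (hf : Measurable f) :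
    Measurable fun p : ℝ × ℝ => K p.2 * f (p.2 * p.1) := by
  fun_prop

/-- For `f ∈ L²(ℝ)` the integral `∫ K(u) f(ux) du` converges absolutely for almost all `x`. -/
theorem ae_integrable {K : ℝ → ℂ} (hK : IsHausdorffKernel K) (f : L2R) :
    ∀ᵐ x : ℝ, Integrable fun u : ℝ => K u * f (u * x) := by
  have hf := (Lp.stronglyMeasurable f).measurable
  have hm := (measurable_inner hK.measurable hf).enorm.lintegral_prod_right' (ν := volume)
  have hfin : ∫⁻ x : ℝ, (∫⁻ u : ℝ, ‖K u * f (u * x)‖ₑ) ^ (2 : ℝ) ≠ ∞ :=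
    ((lintegral_sq_le hK.measurable hf).trans_lt (ENNReal.mul_lt_top
      (ENNReal.rpow_lt_top_of_nonneg (by norm_num) (wt_lt_top hK).ne)
      (lintegral_sq_lt_top f))).ne
  filter_upwards [ae_lt_top (hm.pow_const (2 : ℝ)) hfin] with x hx
  refine ⟨((measurable_inner hK.measurable hf).comp
    (measurable_const.prodMk measurable_id)).aestronglyMeasurable (f := fun u => K u * f (u * x)), ?_⟩
  exact (ENNReal.rpow_lt_top_iff_of_pos (by norm_num)).mp hx

theorem aestronglyMeasurable_fn {K : ℝ → ℂ} (hK : IsHausdorffKernel K) (f : L2R) :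
    AEStronglyMeasurable (fn K f) volume :=
  ((measurable_inner hK.measurable
    (Lp.stronglyMeasurable f).measurable).stronglyMeasurable.integral_prod_right').aestronglyMeasurable

theorem eLpNorm_fn_le {K : ℝ → ℂ} (hK : IsHausdorffKernel K) (f : L2R) :
    eLpNorm (fn K f) 2 volume ≤ wt K * eLpNorm f 2 volume := by
  have hf := (Lp.stronglyMeasurable f).measurable
  rw [eLpNorm_eq_lintegral_rpow_enorm_toReal (by norm_num) (by norm_num),
    eLpNorm_eq_lintegral_rpow_enorm_toReal (by norm_num) (by norm_num)]
  simp only [ENNReal.toReal_ofNat]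
  have h1 : ∫⁻ x : ℝ, ‖fn K f x‖ₑ ^ (2 : ℝ) ≤ wt K ^ (2 : ℝ) * ∫⁻ x : ℝ, ‖f x‖ₑ ^ (2 : ℝ) :=
    (lintegral_mono fun x => ENNReal.rpow_le_rpow (enorm_integral_le_lintegral_enorm _)
      (by norm_num)).trans (lintegral_sq_le hK.measurable hf)
  refine (ENNReal.rpow_le_rpow h1 (by norm_num)).trans (le_of_eq ?_)
  rw [ENNReal.mul_rpow_of_nonneg _ _ (by norm_num), ← ENNReal.rpow_mul]
  norm_num

theorem memLp_fn {K : ℝ → ℂ} (hK : IsHausdorffKernel K) (f : L2R) :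
    MemLp (fn K f) 2 volume :=
  ⟨aestronglyMeasurable_fn hK f, (eLpNorm_fn_le hK f).trans_lt
    (ENNReal.mul_lt_top (wt_lt_top hK) (Lp.memLp f).2)⟩

/-- `∫ K(u) f(ux) du`, for `x ≠ 0`, depends only on the almost everywhere class of `f`. -/
theorem fn_congr (K : ℝ → ℂ) {f g : ℝ → ℂ} (h : f =ᵐ[volume] g) {x : ℝ} (hx : x ≠ 0) :
    fn K f x = fn K g x := by
  refine integral_congr_ae ?_
  have hq : Measure.QuasiMeasurePreserving (fun u : ℝ => u * x) volume volume := by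
    refine ⟨measurable_mul_const x, ?_⟩
    rw [Real.map_volume_mul_right hx]
    exact Measure.smul_absolutelyContinuous
  filter_upwards [hq.ae h] with u hu
  rw [hu]

theorem ae_ne_zero : ∀ᵐ x : ℝ, x ≠ 0 := by
  simp [ae_iff]

end Hausdorff

/-- The Hausdorff operator `(𝓗_K f)(x) = ∫ K(u) f(ux) du` as a bounded operator in `L²(ℝ)`. -/
def hausdorff (K : ℝ → ℂ) (hK : IsHausdorffKernel K) : L2R →L[ℂ] L2R :=
  LinearMap.mkContinuous
    { toFun := fun f => (Hausdorff.memLp_fn hK f).toLp (Hausdorff.fn K f)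
      map_add' := fun f g => by
        rw [← MemLp.toLp_add, MemLp.toLp_eq_toLp_iff]
        filter_upwards [Hausdorff.ae_integrable hK f, Hausdorff.ae_integrable hK g,
          Hausdorff.ae_ne_zero] with x hf hg hx
        rw [Hausdorff.fn_congr K (Lp.coeFn_add f g) hx, Pi.add_apply]
        simp only [Hausdorff.fn, Pi.add_apply, mul_add]
        exact integral_add hf hg
      map_smul' := fun c f => by
        rw [RingHom.id_apply, ← MemLp.toLp_const_smul, MemLp.toLp_eq_toLp_iff]
        filter_upwards [Hausdorff.ae_ne_zero] with x hx
        rw [Hausdorff.fn_congr K (Lp.coeFn_smul c f) hx, Pi.smul_apply]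
        simp only [Hausdorff.fn, Pi.smul_apply, smul_eq_mul, mul_left_comm _ c]
        exact integral_const_mul _ _ }
    (Hausdorff.wt K).toReal fun f => by
      have h := ENNReal.toReal_mono
        (ENNReal.mul_lt_top (Hausdorff.wt_lt_top hK) (Lp.memLp f).2).ne
        (Hausdorff.eLpNorm_fn_le hK f)
      rw [ENNReal.toReal_mul] at h
      rw [LinearMap.coe_mk, AddHom.coe_mk, Lp.norm_toLp, Lp.norm_def]
      exact h

theorem coeFn_hausdorff (K : ℝ → ℂ) (hK : IsHausdorffKernel K) (f : L2R) :
    hausdorff K hK f =ᵐ[volume] fun x => ∫ u : ℝ, K u * f (u * x) :=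
  MemLp.coeFn_toLp (Hausdorff.memLp_fn hK f)

/-- `L²(ℝ₊)` as a subspace of `L²(ℝ)`: the functions that vanish a.e. on the negative half-line. -/
def L2Plus : Submodule ℂ L2R where
  carrier := {f | ∀ᵐ x : ℝ, x < 0 → f x = 0}
  add_mem' {f g} hf hg := by
    filter_upwards [hf, hg, Lp.coeFn_add f g] with x h1 h2 h3 hx
    rw [h3, Pi.add_apply, h1 hx, h2 hx, add_zero]
  zero_mem' := by
    filter_upwards [Lp.coeFn_zero ℂ 2 (volume : Measure ℝ)] with x h _
    rw [h, Pi.zero_apply]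
  smul_mem' c f hf := by
    filter_upwards [hf, Lp.coeFn_smul c f] with x h1 h2 hx
    rw [h2, Pi.smul_apply, h1 hx, smul_zero]

theorem mem_L2Plus {f : L2R} : f ∈ L2Plus ↔ ∀ᵐ x : ℝ, x < 0 → f x = 0 := Iff.rfl

theorem isClosed_L2Plus : IsClosed (L2Plus : Set L2R) := by
  have : (L2Plus : Set L2R) =
      (LpToLpRestrictCLM ℝ ℂ ℂ (volume : Measure ℝ) 2 (Set.Iio 0)) ⁻¹' {0} := by
    ext f
    rw [SetLike.mem_coe, mem_L2Plus, Set.mem_preimage, Set.mem_singleton_iff, Lp.eq_zero_iff_ae_eq_zero]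
    have h := LpToLpRestrictCLM_coeFn ℂ (Set.Iio (0 : ℝ)) f
    have e : (∀ᵐ x : ℝ, x < 0 → f x = 0) ↔ ∀ᵐ x ∂(volume.restrict (Set.Iio (0 : ℝ))), f x = 0 :=
      (ae_restrict_iff' measurableSet_Iio).symm
    rw [e]
    constructor
    · intro hf
      filter_upwards [h, hf] with x h1 h2
      simp [h1, h2]
    · intro hf
      filter_upwards [h, hf] with x h1 h2
      rw [← h1, h2]; rfl
  rw [this]
  exact isClosed_singleton.preimage (ContinuousLinearMap.continuous _)

instance : CompleteSpace L2Plus := isClosed_L2Plus.completeSpace_coe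

/-- The restriction `A₊ = A|L²(ℝ₊)` of a bounded operator `A` in `L²(ℝ)` leaving `L²(ℝ₊)`
invariant. -/
def restrictPlus (A : L2R →L[ℂ] L2R) (hA : ∀ f ∈ L2Plus, A f ∈ L2Plus) : L2Plus →L[ℂ] L2Plus :=
  (A.comp L2Plus.subtypeL).codRestrict L2Plus fun f => hA f f.2

/-- If the kernel vanishes on the negative half-line, then `L²(ℝ₊)` is invariant. -/
theorem hausdorff_mem_L2Plus {K : ℝ → ℂ} (hK : IsHausdorffKernel K) (h0 : ∀ u < 0, K u = 0) :
    ∀ f ∈ L2Plus, hausdorff K hK f ∈ L2Plus := by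
  intro f hf
  rw [mem_L2Plus] at hf ⊢
  filter_upwards [coeFn_hausdorff K hK f] with x hx hneg
  rw [hx]
  refine integral_eq_zero_of_ae ?_
  have hq : Measure.QuasiMeasurePreserving (fun u : ℝ => u * x) volume volume := by
    refine ⟨measurable_mul_const x, ?_⟩
    rw [Real.map_volume_mul_right hneg.ne]
    exact Measure.smul_absolutelyContinuous
  filter_upwards [hq.ae hf, Hausdorff.ae_ne_zero] with u hu hu0
  rcases lt_or_gt_of_ne hu0 with h | h
  · simp [h0 u h]
  · simp [hu (mul_neg_of_pos_of_neg h hneg)]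

/-- The kernel `Γ(α)⁻¹ (log (1/u))^(α-1) χ_{(0,1)}(u)` of the Hölder mean of order `α`. -/
def holderKernel (α : ℂ) : ℝ → ℂ :=
  (Set.Ioo (0 : ℝ) 1).indicator fun u =>
    (Complex.Gamma α)⁻¹ * ((Real.log (1 / u) : ℝ) : ℂ) ^ (α - 1)

theorem isHausdorffKernel_holderKernel {α : ℂ} (hα : 0 < α.re) :
    IsHausdorffKernel (holderKernel α) := by
  have hmeas : Measurable (holderKernel α) := by
    refine Measurable.indicator ?_ measurableSet_Ioo
    refine Measurable.const_mul ?_ _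
    exact Measurable.pow_const (by fun_prop) _
  refine ⟨hmeas, ?_⟩
  have hind : (fun u : ℝ => holderKernel α u * ((|u| ^ (-(1 / 2) : ℝ) : ℝ) : ℂ)) =
      (Set.Ioo (0 : ℝ) 1).indicator fun u => holderKernel α u * ((|u| ^ (-(1 / 2) : ℝ) : ℝ) : ℂ) := by
    ext u
    by_cases hu : u ∈ Set.Ioo (0 : ℝ) 1
    · rw [Set.indicator_of_mem hu]
    · rw [Set.indicator_of_notMem hu, holderKernel, Set.indicator_of_notMem hu, zero_mul]
  rw [hind, integrable_indicator_iff measurableSet_Ioo]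
  have himg : Set.Ioo (0 : ℝ) 1 = (fun t : ℝ => Real.exp (-t)) '' Set.Ioi 0 := by
    ext u
    constructor
    · intro hu
      refine ⟨-Real.log u, ?_, ?_⟩
      · simpa using Real.log_neg hu.1 hu.2
      · simp [Real.exp_log hu.1]
    · rintro ⟨t, ht, rfl⟩
      exact ⟨Real.exp_pos _, Real.exp_lt_one_iff.mpr (by simpa using ht)⟩
  rw [himg, integrableOn_image_iff_integrableOn_abs_deriv_smul measurableSet_Ioi
    (f' := fun t : ℝ => -Real.exp (-t))
    (fun t _ => by simpa using ((hasDerivAt_neg t).exp).hasDerivWithinAt)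
    (fun a _ b _ hab => by simpa using hab)]
  have hG : IntegrableOn (fun t : ℝ => Real.exp (-(1 / 2 : ℝ) * t) * t ^ (α.re - 1)) (Set.Ioi 0) := by
    have h1 := Real.GammaIntegral_convergent hα
    have h2 := (integrableOn_Ioi_comp_mul_left_iff
      (fun t : ℝ => Real.exp (-t) * t ^ (α.re - 1)) 0 (a := (1 / 2 : ℝ)) (by norm_num)).mpr
      (by simpa using h1)
    have h3 := h2.const_mul ((1 / 2 : ℝ) ^ (α.re - 1))⁻¹
    refine IntegrableOn.congr_fun h3 (fun t ht => ?_) measurableSet_Ioi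
    have ht' : (0 : ℝ) < t := ht
    rw [Real.mul_rpow (by norm_num) ht'.le]
    have : ((1 / 2 : ℝ) ^ (α.re - 1)) ≠ 0 := by positivity
    field_simp
  refine Integrable.mono' (hG.const_mul ‖(Complex.Gamma α)⁻¹‖) ?_ ?_
  · refine Measurable.aestronglyMeasurable ?_
    refine Measurable.smul (f := fun t : ℝ => |(-Real.exp (-t))|) (by fun_prop) ?_
    exact Measurable.mul (hmeas.comp (by fun_prop)) (by fun_prop)
  · refine (ae_restrict_iff' measurableSet_Ioi).mpr (Filter.Eventually.of_forall fun t ht => ?_)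
    have ht' : (0 : ℝ) < t := ht
    have hmem : Real.exp (-t) ∈ Set.Ioo (0 : ℝ) 1 :=
      ⟨Real.exp_pos _, Real.exp_lt_one_iff.mpr (by simpa using ht')⟩
    have hlog : Real.log (1 / Real.exp (-t)) = t := by
      rw [one_div, ← Real.exp_neg, neg_neg, Real.log_exp]
    have hpw : |Real.exp (-t)| ^ (-(1 / 2) : ℝ) = Real.exp (1 / 2 * t) := by
      rw [abs_of_pos (Real.exp_pos _), ← Real.exp_mul]; ring_nf
    rw [holderKernel, Set.indicator_of_mem hmem, hlog, hpw, norm_smul, norm_mul, norm_mul,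
      Complex.norm_cpow_eq_rpow_re_of_pos ht', Complex.norm_real, abs_neg, norm_abs_eq_norm,
      Real.norm_of_nonneg (Real.exp_pos _).le, Real.norm_of_nonneg (Real.exp_pos _).le,
      Complex.sub_re, Complex.one_re]
    refine le_of_eq ?_
    have : Real.exp (-(1 / 2 : ℝ) * t) = Real.exp (-t) * Real.exp (1 / 2 * t) := by
      rw [← Real.exp_add]; ring_nf
    rw [this]; ring

theorem holderKernel_of_neg (α : ℂ) : ∀ u < 0, holderKernel α u = 0 := fun _ hu =>
  Set.indicator_of_notMem (fun h => (h.1.trans hu).false) _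

/-- The Hölder mean `(H_α f)(x) = Γ(α)⁻¹ ∫_0^1 (log (1/u))^(α-1) f(ux) du` in `L²(ℝ)`. -/
def holderMean (α : ℂ) (hα : 0 < α.re) : L2R →L[ℂ] L2R :=
  hausdorff (holderKernel α) (isHausdorffKernel_holderKernel hα)

theorem coeFn_holderMean {α : ℂ} (hα : 0 < α.re) (f : L2R) :
    holderMean α hα f =ᵐ[volume] fun x => (Complex.Gamma α)⁻¹ *
      ∫ u in (0 : ℝ)..1, ((Real.log (1 / u) : ℝ) : ℂ) ^ (α - 1) * f (u * x) := by
  filter_upwards [coeFn_hausdorff _ (isHausdorffKernel_holderKernel hα) f] with x hx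
  rw [holderMean, hx, intervalIntegral.integral_of_le zero_le_one, integral_Ioc_eq_integral_Ioo,
    ← integral_const_mul, ← integral_indicator measurableSet_Ioo]
  refine integral_congr_ae (Filter.Eventually.of_forall fun u => ?_)
  by_cases hu : u ∈ Set.Ioo (0 : ℝ) 1
  · simp [holderKernel, hu, mul_assoc]
  · simp only [holderKernel, Set.indicator_of_notMem hu, zero_mul]

/-- The restriction `H_{α+}` of the Hölder mean to `L²(ℝ₊)`. -/
def holderMeanPlus (α : ℂ) (hα : 0 < α.re) : L2Plus →L[ℂ] L2Plus :=
  restrictPlus (holderMean α hα) (hausdorff_mem_L2Plus _ (holderKernel_of_neg α))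

/-- The kernel `χ_{(0,1)}` of the Cesàro operator. -/
def cesaroKernel : ℝ → ℂ := (Set.Ioo (0 : ℝ) 1).indicator fun _ => 1

theorem isHausdorffKernel_cesaroKernel : IsHausdorffKernel cesaroKernel := by
  have h := isHausdorffKernel_holderKernel (α := 1) (by simp)
  have e : holderKernel 1 = cesaroKernel := by
    simp [holderKernel, cesaroKernel]
  rwa [e] at h

theorem cesaroKernel_of_neg : ∀ u < 0, cesaroKernel u = 0 := fun _ hu =>
  Set.indicator_of_notMem (fun h => (h.1.trans hu).false) _

/-- The Cesàro operator `(𝒞 f)(x) = ∫_0^1 f(ux) du` in `L²(ℝ)`. -/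
def cesaro : L2R →L[ℂ] L2R :=
  hausdorff cesaroKernel isHausdorffKernel_cesaroKernel

theorem coeFn_cesaro (f : L2R) :
    cesaro f =ᵐ[volume] fun x => (x : ℂ)⁻¹ * ∫ t in (0 : ℝ)..x, f t := by
  filter_upwards [coeFn_hausdorff _ isHausdorffKernel_cesaroKernel f, Hausdorff.ae_ne_zero]
    with x hx hx0
  have h1 : (∫ u : ℝ, cesaroKernel u * f (u * x)) = ∫ u in (0 : ℝ)..1, f (u * x) := by
    rw [intervalIntegral.integral_of_le zero_le_one, integral_Ioc_eq_integral_Ioo,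
      ← integral_indicator measurableSet_Ioo]
    refine integral_congr_ae (Filter.Eventually.of_forall fun u => ?_)
    by_cases hu : u ∈ Set.Ioo (0 : ℝ) 1 <;> simp [cesaroKernel, hu]
  rw [cesaro, hx, h1, intervalIntegral.integral_comp_mul_right (fun t => f t) hx0]
  simp

/-- The Cesàro operator `𝒞₊` in `L²(ℝ₊)`. -/
def cesaroPlus : L2Plus →L[ℂ] L2Plus :=
  restrictPlus cesaro (hausdorff_mem_L2Plus _ cesaroKernel_of_neg)

/-- The fractional power `T ^ α` of a normal operator `T` in a complex Hilbert space, in the sense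
of the continuous functional calculus, for the principal branch of `z ↦ z ^ α` (so `1 ^ α = 1`, and
`0 ^ α = 0` for `α ≠ 0`). It is meaningful if `T` is normal and `z ↦ z ^ α` is continuous on the
spectrum of `T`. -/
def normalPow {H : Type*} [NormedAddCommGroup H] [InnerProductSpace ℂ H] [CompleteSpace H]
    (T : H →L[ℂ] H) (α : ℂ) : H →L[ℂ] H :=
  cfc (fun z : ℂ => z ^ α) T

end

/-! Write `T` for `cesaroPlus`. Dilation-invariant operators multiply by convolving their kernels
multiplicatively, and the adjoint of `cesaro` has the kernel `χ_{(1,∞)}(u)/u`. Both convolutions of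
these two kernels equal `min(1, 1/w)` for `w > 0`, which is almost everywhere the sum of the
kernels. Hence `T* T = T + T* = T T*`: `T` is normal and `1 - T` is unitary. The spectrum therefore
lies on the circle `|1 - z| = 1`, whose nonzero points satisfy `Re z > 0` and `Re (1/z) = 1/2`.

To a kernel `K` supported in `(0, 1)` associate the symbol `z ↦ ∫ K(u) u^(1/z - 1) du`, its Mellin
transform at `1/z`. For `K = u^n` this is `z/(1 + nz)`, and the operator with that kernel is `T (1 +
nT)⁻¹` (`polyPlus_X_pow_mul_cesaroPlus`); so for polynomial kernels the operator is the functional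
calculus of the symbol (`eq_cfc_polySymbol`). For the Hölder kernel the symbol is `z^α`, by the
Gamma integral.

The norm `∫ |K(u)| |u|^(-1/2) du` bounds both the operator and, on `Re (1/z) = 1/2`, the symbol.
Polynomials are dense for it, so one polynomial approximates `H_{α+}` in operator norm and `z^α`
uniformly on the spectrum away from `0`, where both symbols vanish anyway
(`exists_norm_holderMeanPlus_sub_polyPlus_le`). Passing to the limit gives the theorem. -/

namespace Hausdorff

/-! ### Absolute convergence of Hausdorff integrals. -/

theorem quasiMeasurePreserving_mul_right {x : ℝ} (hx : x ≠ 0) :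
    Measure.QuasiMeasurePreserving (fun u : ℝ => u * x) volume volume := by
  refine ⟨measurable_mul_const x, ?_⟩
  rw [Real.map_volume_mul_right hx]
  exact Measure.smul_absolutelyContinuous

theorem integrable_kernel_mul_congr (K : ℝ → ℂ) {f g : ℝ → ℂ} (h : f =ᵐ[volume] g) {x : ℝ}
    (hx : x ≠ 0) (hf : Integrable fun u => K u * f (u * x)) :
    Integrable fun u => K u * g (u * x) := by
  refine hf.congr ?_
  filter_upwards [(quasiMeasurePreserving_mul_right hx).ae h] with u hu
  rw [hu]

theorem _root_.IsHausdorffKernel.norm {K : ℝ → ℂ} (hK : IsHausdorffKernel K) :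
    IsHausdorffKernel fun u => ((‖K u‖ : ℝ) : ℂ) := by
  have := hK.measurable
  refine ⟨by fun_prop, ?_⟩
  refine hK.integrable.mono (by fun_prop) (Filter.Eventually.of_forall fun u => ?_)
  simp

/-- The function `x ↦ ∫ |K(u) f(ux)| du` belongs to `L²(ℝ)`. -/
theorem memLp_integral_norm {K : ℝ → ℂ} (hK : IsHausdorffKernel K) (f : L2R) :
    MemLp (fun x : ℝ => ((∫ u, ‖K u * f (u * x)‖ : ℝ) : ℂ)) 2 volume := by
  have hf : MemLp (fun x => ((‖f x‖ : ℝ) : ℂ)) 2 volume := (Lp.memLp f).norm.ofReal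
  refine (memLp_congr_ae ?_).mp (memLp_fn hK.norm (hf.toLp _))
  filter_upwards [ae_ne_zero] with x hx
  rw [fn_congr _ hf.coeFn_toLp hx, fn, ← integral_complex_ofReal]
  simp

end Hausdorff

open Hausdorff

/-! ### Products and adjoints of Hausdorff operators. -/

/-- Fubini after the substitution `w = uv`: the kernel of the product is the multiplicative
convolution of the kernels. -/
theorem hausdorff_comp {K L M : ℝ → ℂ} (hK : IsHausdorffKernel K) (hL : IsHausdorffKernel L)
    (hM : IsHausdorffKernel M)
    (h : ∀ᵐ w : ℝ, ∫ u : ℝ, K u * L (w / u) * ((|u|⁻¹ : ℝ) : ℂ) = M w) :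
    hausdorff K hK * hausdorff L hL = hausdorff M hM := by
  ext1 f
  refine Lp.ext ?_
  have hF := memLp_integral_norm hL f
  have hKm := hK.measurable
  have hLm := hL.measurable
  have hfm := (Lp.stronglyMeasurable f).measurable
  filter_upwards [coeFn_hausdorff K hK (hausdorff L hL f), coeFn_hausdorff M hM f, ae_ne_zero,
    ae_integrable hK.norm (hF.toLp _)] with x h1 h2 hx hint
  rw [mul_apply_eq_comp, h1, h2]
  replace hint := integrable_kernel_mul_congr _ hF.coeFn_toLp hx hint
  have hscale : ∀ u : ℝ, u ≠ 0 → ∀ v : ℝ,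
      L (v * u / u) * f (v * u * x) = L v * f (v * (u * x)) := fun u hu v => by
    rw [mul_div_cancel_right₀ _ hu, mul_assoc]
  have hpt : ∀ u : ℝ, u ≠ 0 → ∫ v, L v * f (v * (u * x)) =
      ∫ w, ((|u|⁻¹ : ℝ) : ℂ) * (L (w / u) * f (w * x)) := fun u hu => by
    have := Measure.integral_comp_mul_right (fun w => L (w / u) * f (w * x)) u
    simp only [hscale u hu] at this
    rw [this, integral_const_mul, abs_inv, Complex.real_smul]
  have hptn : ∀ u : ℝ, u ≠ 0 → ∫ v, ‖L v * f (v * (u * x))‖ =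
      ∫ w, ‖((|u|⁻¹ : ℝ) : ℂ) * (L (w / u) * f (w * x))‖ := fun u hu => by
    have := Measure.integral_comp_mul_right (fun w => ‖L (w / u) * f (w * x)‖) u
    simp only [hscale u hu] at this
    simp only [norm_mul _ (L _ * _)]
    rw [this, integral_const_mul, abs_inv, smul_eq_mul]
    simp
  -- The inner integral of the absolute values is `|K(u)| F(ux)` with `F(x) = ∫ |L(v) f(vx)| dv`.
  -- Since `F` is in `L²`, the kernel `|K|` may be applied to it, and this is integrable in `u` for
  -- almost every `x`.
  have hprod : Integrable (Function.uncurry fun u w : ℝ =>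
      K u * (((|u|⁻¹ : ℝ) : ℂ) * (L (w / u) * f (w * x)))) (volume.prod volume) := by
    refine (integrable_prod_iff (Measurable.aestronglyMeasurable ?_)).mpr ⟨?_, ?_⟩
    · simp only [Function.uncurry_def]
      fun_prop
    · filter_upwards [ae_ne_zero,
        (quasiMeasurePreserving_mul_right hx).ae (ae_integrable hL f)] with u hu hu'
      simp only [Function.uncurry]
      refine Integrable.const_mul (Integrable.const_mul ?_ _) _
      rw [← integrable_comp_mul_right_iff _ hu]
      simpa only [hscale u hu] using hu'
    · refine hint.norm.congr ?_
      filter_upwards [ae_ne_zero] with u hu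
      simp only [Function.uncurry]
      simp only [norm_mul (K u)]
      rw [integral_const_mul, ← hptn u hu, norm_mul, Complex.norm_real, norm_norm,
        Complex.norm_real, Real.norm_of_nonneg (integral_nonneg fun _ => norm_nonneg _)]
  calc ∫ u, K u * hausdorff L hL f (u * x)
      = ∫ u, ∫ w, K u * (((|u|⁻¹ : ℝ) : ℂ) * (L (w / u) * f (w * x))) := by
        refine integral_congr_ae ?_
        filter_upwards [ae_ne_zero,
          (quasiMeasurePreserving_mul_right hx).ae (coeFn_hausdorff L hL f)] with u hu hu'
        rw [hu', hpt u hu]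
        simp only [integral_const_mul]
    _ = ∫ w, ∫ u, K u * (((|u|⁻¹ : ℝ) : ℂ) * (L (w / u) * f (w * x))) :=
        integral_integral_swap hprod
    _ = _ := by
        refine integral_congr_ae ?_
        filter_upwards [h] with w hw
        rw [← hw, ← integral_mul_const]
        congr 1; ext u; ring

/-- Fubini in the inner product: `t = ux` turns the operator into an integral operator with kernel
`K(t/x)/|x|`, and `x = vt` turns its conjugate transpose back into a Hausdorff operator. -/
theorem adjoint_hausdorff {K L : ℝ → ℂ} (hK : IsHausdorffKernel K) (hL : IsHausdorffKernel L)
    (h : ∀ v, v ≠ 0 → L v = star (K v⁻¹) * ((|v|⁻¹ : ℝ) : ℂ)) :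
    ContinuousLinearMap.adjoint (hausdorff K hK) = hausdorff L hL := by
  symm
  rw [ContinuousLinearMap.eq_adjoint_iff]
  intro g f
  have hKm := hK.measurable
  have hfm := (Lp.stronglyMeasurable f).measurable
  have hgm := (Lp.stronglyMeasurable g).measurable
  have hscale : ∀ x : ℝ, x ≠ 0 → ∀ u : ℝ, K (u * x / x) * f (u * x) = K u * f (u * x) :=
    fun x hx u => by rw [mul_div_cancel_right₀ _ hx]
  have hpt : ∀ x : ℝ, x ≠ 0 → ∫ u, K u * f (u * x) =
      ∫ t, ((|x|⁻¹ : ℝ) : ℂ) * (K (t / x) * f t) := fun x hx => by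
    have := Measure.integral_comp_mul_right (fun t => K (t / x) * f t) x
    simp only [hscale x hx] at this
    rw [this, integral_const_mul, abs_inv, Complex.real_smul]
  have hptn : ∀ x : ℝ, x ≠ 0 → ∫ u, ‖K u * f (u * x)‖ =
      ∫ t, ‖((|x|⁻¹ : ℝ) : ℂ) * (K (t / x) * f t)‖ := fun x hx => by
    have := Measure.integral_comp_mul_right (fun t => ‖K (t / x) * f t‖) x
    simp only [hscale x hx] at this
    simp only [norm_mul _ (K _ * _)]
    rw [this, integral_const_mul, abs_inv, smul_eq_mul]
    simp
  have hprod : Integrable (Function.uncurry fun x t : ℝ =>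
      star (g x) * (((|x|⁻¹ : ℝ) : ℂ) * (K (t / x) * f t))) (volume.prod volume) := by
    refine (integrable_prod_iff (Measurable.aestronglyMeasurable ?_)).mpr ⟨?_, ?_⟩
    · simp only [Function.uncurry_def]
      fun_prop
    · filter_upwards [ae_ne_zero, ae_integrable hK f] with x hx hx'
      simp only [Function.uncurry]
      refine Integrable.const_mul (Integrable.const_mul ?_ _) _
      rw [← integrable_comp_mul_right_iff _ hx]
      simpa only [hscale x hx] using hx'
    -- The integral over `t` of the absolute values is `|g(x)| ∫ |K(u) f(ux)| du`, a product of two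
    -- `L²` functions of `x`.
    · have hint := ((Lp.memLp g).integrable_mul (memLp_integral_norm hK f)).norm
      refine hint.congr ?_
      filter_upwards [ae_ne_zero] with x hx
      simp only [Function.uncurry]
      simp only [norm_mul (star (g x))]
      rw [integral_const_mul, ← hptn x hx, Pi.mul_apply, norm_mul, norm_star,
        Complex.norm_real, Real.norm_of_nonneg (integral_nonneg fun _ => norm_nonneg _)]
  rw [L2.inner_def, L2.inner_def]
  symm
  calc ∫ x, inner ℂ (g x) (hausdorff K hK f x)
      = ∫ x, ∫ t, star (g x) * (((|x|⁻¹ : ℝ) : ℂ) * (K (t / x) * f t)) := by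
        refine integral_congr_ae ?_
        filter_upwards [ae_ne_zero, coeFn_hausdorff K hK f] with x hx hx'
        rw [hx', hpt x hx, RCLike.inner_apply, mul_comm]
        simp only [integral_const_mul]
        rfl
    _ = ∫ t, ∫ x, star (g x) * (((|x|⁻¹ : ℝ) : ℂ) * (K (t / x) * f t)) :=
        integral_integral_swap hprod
    _ = ∫ t, inner ℂ (hausdorff L hL g t) (f t) := by
        refine integral_congr_ae ?_
        filter_upwards [ae_ne_zero, coeFn_hausdorff L hL g] with t ht ht'
        rw [ht', RCLike.inner_apply, ← integral_conj, ← integral_const_mul]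
        have hs := Measure.integral_comp_mul_right
          (fun x => star (g x) * (((|x|⁻¹ : ℝ) : ℂ) * (K (t / x) * f t))) t
        have ht0 : ((|t| : ℝ) : ℂ) ≠ 0 := by simpa using ht
        have hs' : ∫ x, star (g x) * (((|x|⁻¹ : ℝ) : ℂ) * (K (t / x) * f t)) = ((|t| : ℝ) : ℂ) *
            ∫ v, star (g (v * t)) * (((|v * t|⁻¹ : ℝ) : ℂ) * (K (t / (v * t)) * f t)) := by
          rw [hs, Complex.real_smul, abs_inv, ← mul_assoc]
          simp [ht]
        rw [hs', ← integral_const_mul]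
        refine integral_congr_ae ?_
        filter_upwards [ae_ne_zero] with v hv
        have e : t / (v * t) = v⁻¹ := by field_simp
        simp only [e, h v hv, abs_mul, mul_inv, Complex.ofReal_mul, Complex.ofReal_inv, map_mul,
          starRingEnd_apply, star_star]
        have : star ((|v| : ℝ) : ℂ) = ((|v| : ℝ) : ℂ) := Complex.conj_ofReal _
        rw [star_inv₀, this]
        field_simp

/-! ### Linearity in the kernel, and restriction to the half-line. -/

theorem norm_hausdorff_le {K : ℝ → ℂ} (hK : IsHausdorffKernel K) :
    ‖hausdorff K hK‖ ≤ (Hausdorff.wt K).toReal :=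
  LinearMap.mkContinuous_norm_le _ ENNReal.toReal_nonneg _

theorem IsHausdorffKernel.add {K L : ℝ → ℂ} (hK : IsHausdorffKernel K) (hL : IsHausdorffKernel L) :
    IsHausdorffKernel fun u => K u + L u :=
  ⟨hK.measurable.add hL.measurable, by
    exact (hK.integrable.add hL.integrable).congr (.of_forall fun u => (add_mul _ _ _).symm)⟩

theorem IsHausdorffKernel.const_mul {K : ℝ → ℂ} (hK : IsHausdorffKernel K) (c : ℂ) :
    IsHausdorffKernel fun u => c * K u :=
  ⟨hK.measurable.const_mul c, by
    simpa only [mul_assoc] using hK.integrable.const_mul c⟩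

theorem IsHausdorffKernel.sub {K L : ℝ → ℂ} (hK : IsHausdorffKernel K) (hL : IsHausdorffKernel L) :
    IsHausdorffKernel fun u => K u - L u :=
  ⟨hK.measurable.sub hL.measurable, by
    exact (hK.integrable.sub hL.integrable).congr (.of_forall fun u => (sub_mul _ _ _).symm)⟩

theorem hausdorff_add {K L : ℝ → ℂ} (hK : IsHausdorffKernel K) (hL : IsHausdorffKernel L) :
    hausdorff _ (hK.add hL) = hausdorff K hK + hausdorff L hL := by
  ext1 f
  refine Lp.ext ?_
  filter_upwards [coeFn_hausdorff _ (hK.add hL) f, coeFn_hausdorff K hK f, coeFn_hausdorff L hL f,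
    ae_integrable hK f, ae_integrable hL f,
    Lp.coeFn_add (hausdorff K hK f) (hausdorff L hL f)] with x h1 h2 h3 h4 h5 h6
  rw [add_apply, h6, Pi.add_apply, h1, h2, h3, ← integral_add h4 h5]
  simp only [add_mul]

theorem hausdorff_const_mul {K : ℝ → ℂ} (hK : IsHausdorffKernel K) (c : ℂ) :
    hausdorff _ (hK.const_mul c) = c • hausdorff K hK := by
  ext1 f
  refine Lp.ext ?_
  filter_upwards [coeFn_hausdorff _ (hK.const_mul c) f, coeFn_hausdorff K hK f,
    Lp.coeFn_smul c (hausdorff K hK f)] with x h1 h2 h3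
  rw [smul_apply, h3, Pi.smul_apply, h1, h2, smul_eq_mul, ← integral_const_mul]
  simp only [mul_assoc]

theorem hausdorff_congr {K L : ℝ → ℂ} (hK : IsHausdorffKernel K) (hL : IsHausdorffKernel L)
    (h : K = L) : hausdorff K hK = hausdorff L hL := by
  subst h; rfl

theorem hausdorff_sub {K L : ℝ → ℂ} (hK : IsHausdorffKernel K) (hL : IsHausdorffKernel L) :
    hausdorff _ (hK.sub hL) = hausdorff K hK - hausdorff L hL := by
  rw [eq_sub_iff_add_eq, ← hausdorff_add]
  exact hausdorff_congr _ _ (by simp)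

/-- The subspace is invariant under both operators and carries the inner product of `L²(ℝ)`, so the
adjoint relation needs no projection. -/
theorem adjoint_restrictPlus (A B : L2R →L[ℂ] L2R) (hA : ∀ f ∈ L2Plus, A f ∈ L2Plus)
    (hB : ∀ f ∈ L2Plus, B f ∈ L2Plus) (h : ContinuousLinearMap.adjoint A = B) :
    ContinuousLinearMap.adjoint (restrictPlus A hA) = restrictPlus B hB := by
  symm
  rw [ContinuousLinearMap.eq_adjoint_iff]
  intro f g
  subst h
  exact ContinuousLinearMap.adjoint_inner_left A (g : L2R) (f : L2R)

theorem norm_restrictPlus_le (A : L2R →L[ℂ] L2R) (hA : ∀ f ∈ L2Plus, A f ∈ L2Plus) :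
    ‖restrictPlus A hA‖ ≤ ‖A‖ :=
  ContinuousLinearMap.opNorm_le_bound _ (norm_nonneg _) fun f => A.le_opNorm f

/-! ### Mellin transforms on the unit interval. -/

/-- The Laplace transform of a power function, at complex points of the right half-plane. -/
theorem integral_cpow_mul_cexp_neg_mul_Ioi {a r : ℂ} (ha : 0 < a.re) (hr : 0 < r.re) :
    ∫ t : ℝ in Set.Ioi 0, (t : ℂ) ^ (a - 1) * Complex.exp (-(r * t)) =
      (1 / r) ^ a * Complex.Gamma a := by
  set U : Set ℂ := {z | 0 < z.re} with hU
  have hUo : IsOpen U := isOpen_lt continuous_const Complex.continuous_re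
  have hUc : Convex ℝ U := convex_halfSpace_re_gt 0
  have hmeas : ∀ (b z : ℂ), AEStronglyMeasurable
      (fun t : ℝ => (t : ℂ) ^ b * Complex.exp (-(z * t))) (volume.restrict (Set.Ioi 0)) :=
    fun b z => Measurable.aestronglyMeasurable (by
      refine Measurable.mul (Measurable.pow_const (by fun_prop) _) (by fun_prop))
  have hnorm : ∀ (b z : ℂ) (t : ℝ), 0 < t →
      ‖(t : ℂ) ^ b * Complex.exp (-(z * t))‖ = t ^ b.re * Real.exp (-z.re * t ^ (1 : ℝ)) := by
    intro b z t ht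
    rw [norm_mul, Complex.norm_cpow_eq_rpow_re_of_pos ht, Complex.norm_exp]
    simp
  have hdiff : DifferentiableOn ℂ
      (fun z => ∫ t : ℝ in Set.Ioi 0, (t : ℂ) ^ (a - 1) * Complex.exp (-(z * t))) U := by
    intro z hz
    have hz' : 0 < z.re := hz
    refine DifferentiableAt.differentiableWithinAt (HasDerivAt.differentiableAt
      (hasDerivAt_integral_of_dominated_loc_of_deriv_le
      (F' := fun w (t : ℝ) => (t : ℂ) ^ (a - 1) * (Complex.exp (-(w * t)) * -(t : ℂ)))
      -- On the half-plane `Re w > Re z / 2`, a neighbourhood of `z`, this dominates the derivative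
      -- uniformly in `w`.
      (bound := fun t => t ^ a.re * Real.exp (-(z.re / 2) * t ^ (1 : ℝ)))
      (s := {w : ℂ | z.re / 2 < w.re})
      ((isOpen_lt continuous_const Complex.continuous_re).mem_nhds (half_lt_self hz'))
      (Filter.Eventually.of_forall fun w => hmeas _ w) ?_ ?_ ?_ ?_ ?_).2)
    · refine (integrableOn_rpow_mul_exp_neg_mul_rpow (s := (a - 1).re) (p := 1)
        (by simpa using ha) zero_lt_one hz').mono' (hmeas _ _) ?_
      exact (ae_restrict_iff' measurableSet_Ioi).mpr
        (Filter.Eventually.of_forall fun t ht => (hnorm _ _ t ht).le)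
    · refine Measurable.aestronglyMeasurable ?_
      exact Measurable.mul (Measurable.pow_const (by fun_prop) _) (by fun_prop)
    · refine (ae_restrict_iff' measurableSet_Ioi).mpr
        (Filter.Eventually.of_forall fun t ht w hw => ?_)
      have ht' : (0 : ℝ) < t := ht
      rw [← mul_assoc, norm_mul, hnorm _ _ t ht, norm_neg, Complex.norm_real,
        Real.norm_of_nonneg ht'.le, mul_right_comm]
      have e : t ^ (a - 1).re * t = t ^ a.re := by
        rw [← Real.rpow_add_one ht'.ne']; simp
      rw [e]
      have hw' : z.re / 2 < w.re := hw
      gcongr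
    · exact integrableOn_rpow_mul_exp_neg_mul_rpow (by linarith) zero_lt_one (half_pos hz')
    · refine Filter.Eventually.of_forall fun t w _ => ?_
      refine HasDerivAt.const_mul _ (HasDerivAt.cexp ?_)
      simpa using! ((hasDerivAt_id w).mul_const (t : ℂ)).neg
  have hdiff' : DifferentiableOn ℂ (fun z : ℂ => (1 / z) ^ a * Complex.Gamma a) U := by
    intro z hz
    have hz' : 0 < z.re := hz
    have hz0 : z ≠ 0 := fun h => by simp [h] at hz'
    refine DifferentiableAt.differentiableWithinAt ?_
    refine DifferentiableAt.mul_const (DifferentiableAt.cpow_const ?_ ?_) _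
    · exact (differentiableAt_const _).div differentiableAt_id hz0
    · left
      rw [one_div, Complex.inv_re]
      exact div_pos hz' (Complex.normSq_pos.mpr hz0)
  -- Identity theorem: both sides are holomorphic in `r` on the right half-plane and agree at real
  -- `r > 1`, points that accumulate at `1`.
  refine (hdiff.analyticOnNhd hUo).eqOn_of_preconnected_of_frequently_eq
    (hdiff'.analyticOnNhd hUo) hUc.isPreconnected (z₀ := 1) (by simp [hU]) ?_ hr
  have htend : Filter.Tendsto (fun x : ℝ => (x : ℂ)) (nhdsWithin 1 (Set.Ioi 1))
      (nhdsWithin 1 {1}ᶜ) := by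
    refine tendsto_nhdsWithin_iff.mpr ⟨?_, ?_⟩
    · exact (Complex.continuous_ofReal.tendsto' 1 1 (by simp)).mono_left nhdsWithin_le_nhds
    · filter_upwards [self_mem_nhdsWithin] with x hx
      have : (1 : ℝ) < x := hx
      simpa using this.ne'
  refine htend.frequently (Filter.Eventually.frequently ?_)
  filter_upwards [self_mem_nhdsWithin] with x hx
  exact Complex.integral_cpow_mul_exp_neg_mul_Ioi ha (zero_lt_one.trans hx)

theorem Ioo_zero_one_eq_image_exp_neg :
    Set.Ioo (0 : ℝ) 1 = (fun t : ℝ => Real.exp (-t)) '' Set.Ioi 0 := by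
  ext u
  constructor
  · intro hu
    refine ⟨-Real.log u, ?_, ?_⟩
    · simpa using Real.log_neg hu.1 hu.2
    · simp [Real.exp_log hu.1]
  · rintro ⟨t, ht, rfl⟩
    exact ⟨Real.exp_pos _, Real.exp_lt_one_iff.mpr (by simpa using ht)⟩

/-- The Mellin transform of the kernel of the Hölder mean. -/
theorem integral_holderKernel_mul_cpow {α s : ℂ} (hα : 0 < α.re) (hs : 0 < s.re) :
    ∫ u in Set.Ioo (0 : ℝ) 1, holderKernel α u * (u : ℂ) ^ (s - 1) = (1 / s) ^ α := by
  have key : ∫ u in Set.Ioo (0 : ℝ) 1, holderKernel α u * (u : ℂ) ^ (s - 1) =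
      ∫ t : ℝ in Set.Ioi 0, (Complex.Gamma α)⁻¹ *
        ((t : ℂ) ^ (α - 1) * Complex.exp (-(s * t))) := by
    -- The substitution `u = exp (-t)` turns the Mellin transform into the Laplace transform of
    -- `t^(α-1)`.
    rw [Ioo_zero_one_eq_image_exp_neg, integral_image_eq_integral_abs_deriv_smul measurableSet_Ioi
      (f' := fun t : ℝ => -Real.exp (-t))
      (fun t _ => by simpa using ((hasDerivAt_neg t).exp).hasDerivWithinAt)
      (fun a _ b _ hab => by simpa using hab)]
    refine setIntegral_congr_fun measurableSet_Ioi fun t ht => ?_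
    have hmem : Real.exp (-t) ∈ Set.Ioo (0 : ℝ) 1 :=
      ⟨Real.exp_pos _, Real.exp_lt_one_iff.mpr (by simpa using ht)⟩
    have hlog : Real.log (1 / Real.exp (-t)) = t := by
      rw [one_div, ← Real.exp_neg, neg_neg, Real.log_exp]
    have hpow : ((Real.exp (-t) : ℝ) : ℂ) ^ (s - 1) = Complex.exp (-(t * (s - 1))) := by
      rw [Complex.cpow_def_of_ne_zero (by exact_mod_cast (Real.exp_pos _).ne'),
        ← Complex.ofReal_log (Real.exp_pos _).le, Real.log_exp]
      push_cast; ring_nf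
    simp only [holderKernel, Set.indicator_of_mem hmem, hlog, hpow, abs_neg,
      abs_of_pos (Real.exp_pos _), Complex.real_smul]
    have e : Complex.exp (-(s * t)) = ((Real.exp (-t) : ℝ) : ℂ) * Complex.exp (-(t * (s - 1))) := by
      rw [Complex.ofReal_exp, ← Complex.exp_add]; push_cast; ring_nf
    rw [e]; ring
  rw [key, integral_const_mul, integral_cpow_mul_cexp_neg_mul_Ioi hα hs, mul_comm (_ ^ _),
    inv_mul_cancel_left₀ (Complex.Gamma_ne_zero_of_re_pos hα)]

/-- The Mellin transform of a power function on the unit interval. -/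
theorem integral_pow_mul_cpow {s : ℂ} (hs : 0 < s.re) (n : ℕ) :
    ∫ u in Set.Ioo (0 : ℝ) 1, (u : ℂ) ^ n * (u : ℂ) ^ (s - 1) = 1 / (n + s) := by
  have hre : 0 < (n + s).re := by
    simp only [Complex.add_re, Complex.natCast_re]; positivity
  have hne : (n : ℂ) + s ≠ 0 := fun h => by simp [h] at hre
  have e : ∫ u in Set.Ioo (0 : ℝ) 1, (u : ℂ) ^ n * (u : ℂ) ^ (s - 1) =
      ∫ u in Set.Ioo (0 : ℝ) 1, (u : ℂ) ^ (n + s - 1) := by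
    refine setIntegral_congr_fun measurableSet_Ioo fun u hu => ?_
    rw [add_sub_assoc, Complex.cpow_add _ _ (by exact_mod_cast hu.1.ne'), Complex.cpow_natCast]
  rw [e, ← integral_Ioc_eq_integral_Ioo, ← intervalIntegral.integral_of_le zero_le_one,
    integral_cpow (Or.inl (by simpa using hre))]
  simp [hne]

/-! ### Polynomial kernels and their density. -/

/-- The restriction to `(0, 1)` of a polynomial, as a kernel. -/
noncomputable def polyKernel (p : Polynomial ℂ) : ℝ → ℂ :=
  (Set.Ioo (0 : ℝ) 1).indicator fun u => p.eval (u : ℂ)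

theorem exists_complex_polynomial_near {g : ℝ → ℂ} (hg : Continuous g) {ε : ℝ} (hε : 0 < ε) :
    ∃ p : Polynomial ℂ, ∀ x ∈ Set.Icc (0 : ℝ) 1, ‖p.eval (x : ℂ) - g x‖ < ε := by
  obtain ⟨p, hp⟩ := exists_polynomial_near_of_continuousOn 0 1 (fun x => (g x).re)
    (Complex.continuous_re.comp hg).continuousOn (ε / 2) (half_pos hε)
  obtain ⟨q, hq⟩ := exists_polynomial_near_of_continuousOn 0 1 (fun x => (g x).im)
    (Complex.continuous_im.comp hg).continuousOn (ε / 2) (half_pos hε)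
  refine ⟨p.map (algebraMap ℝ ℂ) + Polynomial.C Complex.I * q.map (algebraMap ℝ ℂ),
    fun x hx => ?_⟩
  have hev : ∀ r : Polynomial ℝ, (r.map (algebraMap ℝ ℂ)).eval (x : ℂ) = ((r.eval x : ℝ) : ℂ) :=
    fun r => by
      rw [Polynomial.eval_map_algebraMap]
      exact Polynomial.aeval_algebraMap_apply_eq_algebraMap_eval x r
  rw [Polynomial.eval_add, Polynomial.eval_mul, Polynomial.eval_C, hev, hev]
  have e : ((p.eval x : ℝ) : ℂ) + Complex.I * ((q.eval x : ℝ) : ℂ) - g x =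
      ((p.eval x - (g x).re : ℝ) : ℂ) + Complex.I * ((q.eval x - (g x).im : ℝ) : ℂ) := by
    nth_rewrite 1 [← Complex.re_add_im (g x)]
    push_cast; ring
  rw [e]
  refine (norm_add_le _ _).trans_lt ?_
  rw [norm_mul, Complex.norm_I, one_mul, Complex.norm_real, Complex.norm_real, Real.norm_eq_abs,
    Real.norm_eq_abs]
  linarith [hp x hx, hq x hx]

theorem measurable_polyKernel (p : Polynomial ℂ) : Measurable (polyKernel p) :=
  Measurable.indicator (by fun_prop) measurableSet_Ioo

theorem integrableOn_abs_rpow_neg_half :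
    IntegrableOn (fun u : ℝ => |u| ^ (-(1 / 2) : ℝ)) (Set.Ioo 0 1) := by
  have h := (intervalIntegral.integrableOn_Ioo_rpow_iff (s := -(1 / 2)) zero_lt_one).mpr
    (by norm_num)
  refine h.congr_fun (fun u hu => ?_) measurableSet_Ioo
  simp only [abs_of_pos hu.1]

theorem isHausdorffKernel_polyKernel (p : Polynomial ℂ) : IsHausdorffKernel (polyKernel p) := by
  refine ⟨measurable_polyKernel p, ?_⟩
  obtain ⟨B, hB⟩ := isCompact_Icc.exists_bound_of_continuousOn (s := Set.Icc (0 : ℝ) 1)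
    (f := fun u : ℝ => p.eval (u : ℂ)) (by fun_prop)
  refine ((integrable_indicator_iff measurableSet_Ioo).mpr
    (integrableOn_abs_rpow_neg_half.const_mul B)).mono'
    (((measurable_polyKernel p).mul (by fun_prop)).aestronglyMeasurable)
    (Filter.Eventually.of_forall fun u => ?_)
  by_cases hu : u ∈ Set.Ioo (0 : ℝ) 1
  · rw [norm_mul, polyKernel, Set.indicator_of_mem hu, Set.indicator_of_mem hu, Complex.norm_real,
      Real.norm_of_nonneg (by positivity)]
    exact mul_le_mul_of_nonneg_right (hB u (Set.Ioo_subset_Icc_self hu)) (by positivity)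
  · simp [polyKernel, Set.indicator_of_notMem hu]

theorem polyKernel_of_neg (p : Polynomial ℂ) : ∀ u < 0, polyKernel p u = 0 := fun _ hu =>
  Set.indicator_of_notMem (fun h => (h.1.trans hu).false) _

/-- Polynomials are dense among the kernels supported in `(0, 1)`. -/
theorem exists_wt_sub_polyKernel_le {K : ℝ → ℂ} (hK : IsHausdorffKernel K)
    (hsupp : ∀ u, u ∉ Set.Ioo (0 : ℝ) 1 → K u = 0) {ε : ENNReal} (hε : ε ≠ 0) :
    ∃ p : Polynomial ℂ, Hausdorff.wt (fun u => K u - polyKernel p u) ≤ ε := by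
  set w : ℝ → ENNReal := fun u => ENNReal.ofReal (|u| ^ (-(1 / 2) : ℝ)) with hw
  have hwm : Measurable w := by simp only [hw]; fun_prop
  -- With the weight absorbed into a measure, `wt` is an `L¹` norm. As `|u|^(-1/2)` is integrable on
  -- `(0, 1)`, the measure is finite, so continuous functions are dense and a uniform error `δ`
  -- costs at most `δ μ(univ)`.
  set μ : Measure ℝ := (volume.restrict (Set.Ioo (0 : ℝ) 1)).withDensity w with hμ
  have hfin : IsFiniteMeasure μ := isFiniteMeasure_withDensity_ofReal
    integrableOn_abs_rpow_neg_half.2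
  have hwt : ∀ F : ℝ → ℂ, Measurable F → (∀ u, u ∉ Set.Ioo (0 : ℝ) 1 → F u = 0) →
      Hausdorff.wt F = eLpNorm F 1 μ := by
    intro F hF hF0
    rw [eLpNorm_one_eq_lintegral_enorm, hμ,
      lintegral_withDensity_eq_lintegral_mul _ hwm hF.enorm, Hausdorff.wt,
      ← lintegral_indicator measurableSet_Ioo]
    congr 1; ext u
    by_cases hu : u ∈ Set.Ioo (0 : ℝ) 1
    · rw [Set.indicator_of_mem hu, Pi.mul_apply, enorm_mul, mul_comm, ← ofReal_norm (E := ℂ) (_ : ℂ),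
        Complex.norm_real, Real.norm_of_nonneg (by positivity)]
    · rw [Set.indicator_of_notMem hu, hF0 u hu]; simp
  have hKμ : MemLp K 1 μ := ⟨hK.measurable.aestronglyMeasurable, by
    rw [← hwt K hK.measurable hsupp]; exact Hausdorff.wt_lt_top hK⟩
  obtain ⟨g, hg, -⟩ := hKμ.exists_boundedContinuous_eLpNorm_sub_le ENNReal.one_ne_top
    (ENNReal.half_pos hε).ne'
  obtain ⟨δ, hδ, hδ'⟩ : ∃ δ : ℝ, 0 < δ ∧ ENNReal.ofReal δ * μ Set.univ ≤ ε / 2 := by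
    obtain ⟨δ, hδ, h⟩ := ENNReal.exists_nnreal_pos_mul_lt (measure_ne_top μ Set.univ)
      (ENNReal.half_pos hε).ne'
    exact ⟨δ, hδ, by simpa using h.le⟩
  obtain ⟨p, hp⟩ := exists_complex_polynomial_near g.continuous hδ
  refine ⟨p, ?_⟩
  rw [hwt (fun u => K u - polyKernel p u) (hK.measurable.sub (measurable_polyKernel p)) fun u hu => by
    simp [hsupp u hu, polyKernel, Set.indicator_of_notMem hu]]
  have hsplit : (fun u => K u - polyKernel p u) = (K - ⇑g) + (⇑g - polyKernel p) := by
    ext u; simp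
  have hgm : Measurable ⇑g := g.continuous.measurable
  rw [hsplit]
  refine (eLpNorm_add_le (hK.measurable.sub hgm).aestronglyMeasurable
    (hgm.sub (measurable_polyKernel p)).aestronglyMeasurable le_rfl).trans ?_
  rw [← ENNReal.add_halves ε]
  refine add_le_add hg ?_
  have hae : ∀ᵐ u ∂μ, ‖(⇑g - polyKernel p) u‖ ≤ δ := by
    refine (withDensity_absolutelyContinuous _ _).ae_le ?_
    refine (ae_restrict_iff' measurableSet_Ioo).mpr (Filter.Eventually.of_forall fun u hu => ?_)
    rw [Pi.sub_apply, polyKernel, Set.indicator_of_mem hu, norm_sub_rev]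
    exact (hp u (Set.Ioo_subset_Icc_self hu)).le
  refine (eLpNorm_le_of_ae_bound hae).trans ?_
  simpa [mul_comm] using hδ'

/-! ### Operators with polynomial kernels and the resolvent identity. -/

/-- The Hausdorff operator in `L²(ℝ₊)` whose kernel is a polynomial restricted to `(0, 1)`. -/
noncomputable def polyPlus (p : Polynomial ℂ) : L2Plus →L[ℂ] L2Plus :=
  restrictPlus (hausdorff _ (isHausdorffKernel_polyKernel p))
    (hausdorff_mem_L2Plus _ (polyKernel_of_neg p))

theorem polyKernel_one : polyKernel 1 = cesaroKernel := by
  simp [polyKernel, cesaroKernel]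

theorem polyPlus_one : polyPlus 1 = cesaroPlus := by
  have := hausdorff_congr (isHausdorffKernel_polyKernel 1) isHausdorffKernel_cesaroKernel
    polyKernel_one
  simp only [polyPlus, cesaroPlus, cesaro, this]

theorem polyKernel_add (p q : Polynomial ℂ) :
    polyKernel (p + q) = fun u => polyKernel p u + polyKernel q u := by
  ext u
  by_cases hu : u ∈ Set.Ioo (0 : ℝ) 1 <;> simp [polyKernel, hu]

theorem polyKernel_C_mul (c : ℂ) (p : Polynomial ℂ) :
    polyKernel (Polynomial.C c * p) = fun u => c * polyKernel p u := by
  ext u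
  by_cases hu : u ∈ Set.Ioo (0 : ℝ) 1 <;> simp [polyKernel, hu]

theorem polyPlus_add (p q : Polynomial ℂ) : polyPlus (p + q) = polyPlus p + polyPlus q := by
  have h := (hausdorff_congr (isHausdorffKernel_polyKernel (p + q)) _ (polyKernel_add p q)).trans
    (hausdorff_add (isHausdorffKernel_polyKernel p) (isHausdorffKernel_polyKernel q))
  simp only [polyPlus, h]
  rfl

theorem polyPlus_C_mul (c : ℂ) (p : Polynomial ℂ) :
    polyPlus (Polynomial.C c * p) = c • polyPlus p := by
  have h := (hausdorff_congr (isHausdorffKernel_polyKernel _) _ (polyKernel_C_mul c p)).trans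
    (hausdorff_const_mul (isHausdorffKernel_polyKernel p) c)
  simp only [polyPlus, h]
  rfl

/-- For `0 < w < 1` the convolution is `∫_w^1 u^m du = (1 - w^(m+1))/(m+1)`. The right side is
spelled so that `polyPlus_add` and `polyPlus_C_mul` apply to it. -/
theorem integral_polyKernel_X_pow_mul_cesaroKernel (m : ℕ) (w : ℝ) :
    ∫ u : ℝ, polyKernel (Polynomial.X ^ (m + 1)) u * cesaroKernel (w / u) * ((|u|⁻¹ : ℝ) : ℂ) =
      polyKernel (Polynomial.C ((m + 1 : ℂ)⁻¹) * (1 + Polynomial.C (-1) * Polynomial.X ^ (m + 1)))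
        w := by
  have e : (fun u : ℝ => polyKernel (Polynomial.X ^ (m + 1)) u * cesaroKernel (w / u) *
      ((|u|⁻¹ : ℝ) : ℂ)) =
      (Set.Ioo (0 : ℝ) 1 ∩ {u | 0 < w ∧ w < u}).indicator fun u : ℝ => (u : ℂ) ^ m := by
    ext u
    by_cases hu : u ∈ Set.Ioo (0 : ℝ) 1
    · have hu0 : (u : ℂ) ≠ 0 := by exact_mod_cast hu.1.ne'
      by_cases hwu : 0 < w ∧ w < u
      · have h1 : w / u ∈ Set.Ioo (0 : ℝ) 1 := ⟨div_pos hwu.1 hu.1, (div_lt_one hu.1).mpr hwu.2⟩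
        rw [Set.indicator_of_mem (Set.mem_inter hu hwu), polyKernel, cesaroKernel,
          Set.indicator_of_mem hu, Set.indicator_of_mem h1, abs_of_pos hu.1]
        simp [pow_succ, hu0]
      · have h1 : w / u ∉ Set.Ioo (0 : ℝ) 1 := fun h =>
          hwu ⟨(div_pos_iff_of_pos_right hu.1).mp h.1, (div_lt_one hu.1).mp h.2⟩
        rw [Set.indicator_of_notMem fun h => hwu h.2, cesaroKernel, Set.indicator_of_notMem h1]
        simp
    · rw [Set.indicator_of_notMem fun h => hu h.1, polyKernel, Set.indicator_of_notMem hu]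
      simp
  rw [e]
  by_cases hw1 : w ∈ Set.Ioo (0 : ℝ) 1
  · have e2 : Set.Ioo (0 : ℝ) 1 ∩ {u | 0 < w ∧ w < u} = Set.Ioo w 1 := by
      ext u
      exact ⟨fun h => ⟨h.2.2, h.1.2⟩, fun h => ⟨⟨hw1.1.trans h.1, h.2⟩, hw1.1, h.1⟩⟩
    have hc : ∫ u in w..1, (u : ℂ) ^ m = ((∫ u in w..1, u ^ m : ℝ) : ℂ) := by
      rw [← intervalIntegral.integral_ofReal]; simp
    rw [e2, integral_indicator measurableSet_Ioo, ← integral_Ioc_eq_integral_Ioo,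
      ← intervalIntegral.integral_of_le hw1.2.le, hc, integral_pow, polyKernel,
      Set.indicator_of_mem hw1]
    simp only [Polynomial.eval_mul, Polynomial.eval_C, Polynomial.eval_add, Polynomial.eval_one,
      Polynomial.eval_pow, Polynomial.eval_X]
    push_cast
    ring
  · have e2 : Set.Ioo (0 : ℝ) 1 ∩ {u | 0 < w ∧ w < u} = ∅ :=
      Set.eq_empty_of_forall_notMem fun u h => hw1 ⟨h.2.1, h.2.2.trans h.1.2⟩
    rw [e2, polyKernel, Set.indicator_of_notMem hw1]
    simp

theorem zero_smul_add {V : Type*} [AddCommGroup V] [Module ℂ V] (x y : V) :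
    (0 : ℂ) • x + y = y := by
  rw [zero_smul, zero_add]

theorem smul_inv_smul_add_neg_one_smul_add {V : Type*} [AddCommGroup V] [Module ℂ V] {c : ℂ}
    (hc : c ≠ 0) (x y : V) : c • c⁻¹ • (x + (-1 : ℂ) • y) + y = x := by
  rw [smul_inv_smul₀ hc, neg_one_smul, neg_add_cancel_right]

/-- This is `polyPlus (X ^ n) = T (1 + nT)⁻¹` with the inverse cleared. For `n = 0` it reduces to
`polyPlus 1 = T`; there the convolution would be a logarithm, not a polynomial, but its coefficient
is zero. -/
theorem polyPlus_X_pow_mul_cesaroPlus (n : ℕ) :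
    (n : ℂ) • (polyPlus (Polynomial.X ^ n) * cesaroPlus) + polyPlus (Polynomial.X ^ n) =
      cesaroPlus := by
  cases n with
  | zero =>
    rw [pow_zero, polyPlus_one, Nat.cast_zero]
    exact zero_smul_add _ _
  | succ m =>
    have h := hausdorff_comp (isHausdorffKernel_polyKernel (Polynomial.X ^ (m + 1)))
      isHausdorffKernel_cesaroKernel (isHausdorffKernel_polyKernel (Polynomial.C ((m + 1 : ℂ)⁻¹) *
        (1 + Polynomial.C (-1) * Polynomial.X ^ (m + 1))))
      (Filter.Eventually.of_forall (integral_polyKernel_X_pow_mul_cesaroKernel m))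
    have h' : polyPlus (Polynomial.X ^ (m + 1)) * cesaroPlus =
        polyPlus (Polynomial.C ((m + 1 : ℂ)⁻¹) *
          (1 + Polynomial.C (-1) * Polynomial.X ^ (m + 1))) := by
      simp only [polyPlus, ← h]
      rfl
    have hm : (m + 1 : ℂ) ≠ 0 := by exact_mod_cast m.succ_ne_zero
    rw [h', polyPlus_C_mul, polyPlus_add, polyPlus_C_mul, polyPlus_one, Nat.cast_succ]
    exact smul_inv_smul_add_neg_one_smul_add hm _ _

/-! ### The adjoint of the Cesàro operator and the relation `T* T = T + T* = T T*`. -/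

/-- The kernel of the adjoint of the Cesàro operator. -/
noncomputable def cesaroDualKernel : ℝ → ℂ := (Set.Ioi (1 : ℝ)).indicator fun u => (u : ℂ)⁻¹

theorem isHausdorffKernel_cesaroDualKernel : IsHausdorffKernel cesaroDualKernel := by
  have hm : Measurable cesaroDualKernel := Measurable.indicator (by fun_prop) measurableSet_Ioi
  refine ⟨hm, ?_⟩
  have h := integrableOn_Ioi_rpow_of_lt (a := -(3 / 2)) (by norm_num) zero_lt_one
  refine ((integrable_indicator_iff measurableSet_Ioi).mpr h).mono'
    ((hm.mul (by fun_prop)).aestronglyMeasurable) (Filter.Eventually.of_forall fun u => ?_)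
  by_cases hu : u ∈ Set.Ioi (1 : ℝ)
  · have hu0 : 0 < u := zero_lt_one.trans hu
    rw [norm_mul, cesaroDualKernel, Set.indicator_of_mem hu, Set.indicator_of_mem hu,
      Complex.norm_real, norm_inv, Complex.norm_real, abs_of_pos hu0, Real.norm_of_nonneg hu0.le,
      Real.norm_of_nonneg (by positivity), ← Real.rpow_neg_one, ← Real.rpow_add hu0]
    norm_num
  · simp [cesaroDualKernel, Set.indicator_of_notMem hu]

theorem cesaroDualKernel_of_neg : ∀ u < 0, cesaroDualKernel u = 0 := fun _ hu =>
  Set.indicator_of_notMem (fun h => ((zero_lt_one.trans h).trans hu).false) _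

theorem adjoint_cesaro :
    ContinuousLinearMap.adjoint cesaro = hausdorff _ isHausdorffKernel_cesaroDualKernel := by
  refine adjoint_hausdorff _ _ fun v hv => ?_
  by_cases h : 1 < v
  · have h0 : 0 < v := zero_lt_one.trans h
    have h1 : v⁻¹ ∈ Set.Ioo (0 : ℝ) 1 := ⟨inv_pos.mpr h0, inv_lt_one_of_one_lt₀ h⟩
    rw [cesaroDualKernel, cesaroKernel, Set.indicator_of_mem h1, Set.indicator_of_mem (Set.mem_Ioi.mpr h),
      abs_of_pos h0]
    simp
  · have h1 : v⁻¹ ∉ Set.Ioo (0 : ℝ) 1 := fun h' =>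
      h ((inv_lt_one₀ (inv_pos.mp h'.1)).mp h'.2)
    rw [cesaroDualKernel, cesaroKernel, Set.indicator_of_notMem h1, Set.indicator_of_notMem (Set.notMem_Ioi.mpr (not_lt.mp h))]
    simp

/-- For `w > 0` the integral is `min(w, 1)/w`, which is `1` below `w = 1` and `1/w` above. At `w =
1` it equals `1` while both kernels vanish. -/
theorem integral_cesaroKernel_mul_cesaroDualKernel {w : ℝ} (hw : w ≠ 0) (hw1 : w ≠ 1) :
    ∫ u : ℝ, cesaroKernel u * cesaroDualKernel (w / u) * ((|u|⁻¹ : ℝ) : ℂ) =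
      cesaroKernel w + cesaroDualKernel w := by
  have e : (fun u : ℝ => cesaroKernel u * cesaroDualKernel (w / u) * ((|u|⁻¹ : ℝ) : ℂ)) =
      (Set.Ioo (0 : ℝ) (min w 1)).indicator fun _ => (w : ℂ)⁻¹ := by
    ext u
    by_cases hu : u ∈ Set.Ioo (0 : ℝ) 1
    · have hu0 : (u : ℂ) ≠ 0 := by exact_mod_cast hu.1.ne'
      have hiff : w / u ∈ Set.Ioi (1 : ℝ) ↔ u < w := one_lt_div hu.1
      by_cases hwu : u < w
      · rw [Set.indicator_of_mem (Set.mem_Ioo.mpr ⟨hu.1, lt_min hwu hu.2⟩), cesaroKernel, cesaroDualKernel,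
          Set.indicator_of_mem hu, Set.indicator_of_mem (hiff.mpr hwu), abs_of_pos hu.1]
        push_cast
        field_simp
      · rw [Set.indicator_of_notMem fun h => hwu (h.2.trans_le (min_le_left _ _)),
          cesaroDualKernel, Set.indicator_of_notMem (hiff.not.mpr hwu)]
        simp
    · rw [Set.indicator_of_notMem fun h => hu ⟨h.1, h.2.trans_le (min_le_right _ _)⟩,
        cesaroKernel, Set.indicator_of_notMem hu]
      simp
  rw [e, integral_indicator measurableSet_Ioo, setIntegral_const, Measure.real, Real.volume_Ioo,
    sub_zero, Complex.real_smul]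
  rcases lt_or_gt_of_ne hw with h0 | h0
  · rw [cesaroKernel_of_neg w h0, cesaroDualKernel_of_neg w h0, min_eq_left (by linarith),
      ENNReal.ofReal_of_nonpos h0.le]
    simp
  · have hw0 : (w : ℂ) ≠ 0 := by exact_mod_cast hw
    rcases lt_or_gt_of_ne hw1 with h1 | h1
    · rw [min_eq_left h1.le, ENNReal.toReal_ofReal h0.le, cesaroKernel, cesaroDualKernel,
        Set.indicator_of_mem (Set.mem_Ioo.mpr ⟨h0, h1⟩), Set.indicator_of_notMem (by simpa using h1.le)]
      simp [hw0]
    · rw [min_eq_right h1.le, cesaroKernel, cesaroDualKernel,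
        Set.indicator_of_notMem fun h => h1.not_gt h.2, Set.indicator_of_mem (Set.mem_Ioi.mpr h1)]
      simp

/-- For `w > 0` the integral is `∫ u^(-2) du` over `u > max(w, 1)`, that is `1/max(w, 1) = min(w,
1)/w`: the same value as for the opposite order, whence normality. -/
theorem integral_cesaroDualKernel_mul_cesaroKernel {w : ℝ} (hw : w ≠ 0) (hw1 : w ≠ 1) :
    ∫ u : ℝ, cesaroDualKernel u * cesaroKernel (w / u) * ((|u|⁻¹ : ℝ) : ℂ) =
      cesaroKernel w + cesaroDualKernel w := by
  have e : (fun u : ℝ => cesaroDualKernel u * cesaroKernel (w / u) * ((|u|⁻¹ : ℝ) : ℂ)) =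
      {u : ℝ | 0 < w ∧ max w 1 < u}.indicator fun u => ((u ^ (-2 : ℝ) : ℝ) : ℂ) := by
    ext u
    by_cases hu : u ∈ Set.Ioi (1 : ℝ)
    · have hu0 : 0 < u := zero_lt_one.trans hu
      have hiff : w / u ∈ Set.Ioo (0 : ℝ) 1 ↔ 0 < w ∧ w < u :=
        and_congr (div_pos_iff_of_pos_right hu0) (div_lt_one hu0)
      by_cases hwu : 0 < w ∧ w < u
      · have hmem : u ∈ {u : ℝ | 0 < w ∧ max w 1 < u} := ⟨hwu.1, max_lt hwu.2 hu⟩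
        rw [Set.indicator_of_mem hmem, cesaroKernel, cesaroDualKernel,
          Set.indicator_of_mem hu, Set.indicator_of_mem (hiff.mpr hwu), abs_of_pos hu0,
          Real.rpow_neg hu0.le]
        simp [sq]
      · rw [Set.indicator_of_notMem fun h => hwu ⟨h.1, (le_max_left _ _).trans_lt h.2⟩,
          cesaroKernel, Set.indicator_of_notMem (hiff.not.mpr hwu)]
        simp
    · rw [Set.indicator_of_notMem fun h => hu ((le_max_right _ _).trans_lt h.2),
        cesaroDualKernel, Set.indicator_of_notMem hu]
      simp
  rw [e]
  rcases lt_or_gt_of_ne hw with h0 | h0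
  · have : {u : ℝ | 0 < w ∧ max w 1 < u} = ∅ :=
      Set.eq_empty_of_forall_notMem fun u h => h0.not_gt h.1
    rw [cesaroKernel_of_neg w h0, cesaroDualKernel_of_neg w h0, this]
    simp
  · have hset : {u : ℝ | 0 < w ∧ max w 1 < u} = Set.Ioi (max w 1) := by
      ext u; exact ⟨fun h => h.2, fun h => ⟨h0, h⟩⟩
    have hpos : 0 < max w 1 := h0.trans_le (le_max_left _ _)
    rw [hset, integral_indicator measurableSet_Ioi, integral_complex_ofReal,
      integral_Ioi_rpow_of_lt (by norm_num) hpos]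
    have e1 : -(max w 1) ^ ((-2 : ℝ) + 1) / (-2 + 1) = (max w 1)⁻¹ := by
      rw [← Real.rpow_neg_one]; norm_num
    rw [e1]
    rcases lt_or_gt_of_ne hw1 with h1 | h1
    · rw [max_eq_right h1.le, cesaroKernel, cesaroDualKernel,
        Set.indicator_of_mem (Set.mem_Ioo.mpr ⟨h0, h1⟩), Set.indicator_of_notMem (by simpa using h1.le)]
      simp
    · rw [max_eq_left h1.le, cesaroKernel, cesaroDualKernel,
        Set.indicator_of_notMem fun h => h1.not_gt h.2, Set.indicator_of_mem (Set.mem_Ioi.mpr h1)]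
      simp

theorem ae_ne_zero_and_ne_one : ∀ᵐ w : ℝ, w ≠ 0 ∧ w ≠ 1 :=
  Hausdorff.ae_ne_zero.and (compl_mem_ae_iff.mpr (measure_singleton (1 : ℝ)))

theorem adjoint_cesaro_mul_cesaro :
    ContinuousLinearMap.adjoint cesaro * cesaro =
      cesaro + ContinuousLinearMap.adjoint cesaro := by
  rw [adjoint_cesaro, cesaro, ← hausdorff_add]
  exact hausdorff_comp _ _ _ (ae_ne_zero_and_ne_one.mono fun w hw =>
    integral_cesaroDualKernel_mul_cesaroKernel hw.1 hw.2)

theorem cesaro_mul_adjoint_cesaro :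
    cesaro * ContinuousLinearMap.adjoint cesaro =
      cesaro + ContinuousLinearMap.adjoint cesaro := by
  rw [adjoint_cesaro, cesaro, ← hausdorff_add]
  exact hausdorff_comp _ _ _ (ae_ne_zero_and_ne_one.mono fun w hw =>
    integral_cesaroKernel_mul_cesaroDualKernel hw.1 hw.2)

theorem adjoint_cesaro_mem_L2Plus :
    ∀ f ∈ L2Plus, ContinuousLinearMap.adjoint cesaro f ∈ L2Plus := by
  rw [adjoint_cesaro]
  exact hausdorff_mem_L2Plus _ cesaroDualKernel_of_neg

theorem star_cesaroPlus :
    star cesaroPlus =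
      restrictPlus (ContinuousLinearMap.adjoint cesaro) adjoint_cesaro_mem_L2Plus :=
  adjoint_restrictPlus _ _ _ _ rfl

theorem star_cesaroPlus_mul_self : star cesaroPlus * cesaroPlus = cesaroPlus + star cesaroPlus := by
  rw [star_cesaroPlus]
  ext1 f
  exact Subtype.ext (DFunLike.congr_fun adjoint_cesaro_mul_cesaro (f : L2R))

theorem cesaroPlus_mul_star_self : cesaroPlus * star cesaroPlus = cesaroPlus + star cesaroPlus := by
  rw [star_cesaroPlus]
  ext1 f
  exact Subtype.ext (DFunLike.congr_fun cesaro_mul_adjoint_cesaro (f : L2R))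

/-! ### Symbols as Mellin transforms on the line `Re (1/z) = 1/2`. -/

/-- The symbol of `polyPlus p`, as a function of the spectral variable of the Cesàro operator. -/
noncomputable def polySymbol (p : Polynomial ℂ) (z : ℂ) : ℂ :=
  p.sum fun n a => a * (z * (1 + n * z)⁻¹)

theorem polySymbol_zero_right (p : Polynomial ℂ) : polySymbol p 0 = 0 := by
  simp [polySymbol, Polynomial.sum]

theorem polySymbol_add (p q : Polynomial ℂ) (z : ℂ) :
    polySymbol (p + q) z = polySymbol p z + polySymbol q z :=
  Polynomial.sum_add_index _ _ _ (by simp) (by intros; ring)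

theorem polySymbol_monomial (n : ℕ) (a z : ℂ) :
    polySymbol (Polynomial.monomial n a) z = a * (z * (1 + n * z)⁻¹) :=
  Polynomial.sum_monomial_index _ _ (by simp)

/-- On the line `Re s = 1/2`, with `s = 1/z`, the Mellin weight has exactly the modulus of the
weight in `IsHausdorffKernel`. -/
theorem norm_cpow_one_div_sub_one {z : ℂ} (hz : (1 / z).re = 1 / 2) {u : ℝ} (hu : 0 < u) :
    ‖(u : ℂ) ^ (1 / z - 1)‖ = |u| ^ (-(1 / 2) : ℝ) := by
  rw [Complex.norm_cpow_eq_rpow_re_of_pos hu, Complex.sub_re, hz, abs_of_pos hu, Complex.one_re]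
  norm_num

theorem measurable_ofReal_cpow_const (c : ℂ) : Measurable fun u : ℝ => (u : ℂ) ^ c :=
  Measurable.pow_const (by fun_prop) _

theorem IsHausdorffKernel.integrableOn_mul_cpow {K : ℝ → ℂ} (hK : IsHausdorffKernel K) {z : ℂ}
    (hz : (1 / z).re = 1 / 2) :
    IntegrableOn (fun u : ℝ => K u * (u : ℂ) ^ (1 / z - 1)) (Set.Ioo 0 1) := by
  refine Integrable.mono (hK.integrable.integrableOn (s := Set.Ioo 0 1))
    (hK.measurable.mul (measurable_ofReal_cpow_const _)).aestronglyMeasurable ?_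
  refine (ae_restrict_iff' measurableSet_Ioo).mpr (Filter.Eventually.of_forall fun u hu => ?_)
  rw [norm_mul, norm_mul, norm_cpow_one_div_sub_one hz hu.1, Complex.norm_real,
    Real.norm_of_nonneg (by positivity)]

/-- The counterpart for symbols of `norm_hausdorff_le`: the same norm of the kernel controls
operator and symbol. -/
theorem norm_integral_mul_cpow_le {K : ℝ → ℂ} (hK : IsHausdorffKernel K) {z : ℂ}
    (hz : (1 / z).re = 1 / 2) :
    ‖∫ u in Set.Ioo (0 : ℝ) 1, K u * (u : ℂ) ^ (1 / z - 1)‖ ≤ (Hausdorff.wt K).toReal := by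
  rw [← toReal_enorm]
  refine ENNReal.toReal_mono (Hausdorff.wt_lt_top hK).ne ?_
  refine (enorm_integral_le_lintegral_enorm _).trans ?_
  refine (lintegral_mono_ae ?_).trans (setLIntegral_le_lintegral (Set.Ioo (0 : ℝ) 1) _)
  refine (ae_restrict_iff' measurableSet_Ioo).mpr (Filter.Eventually.of_forall fun u hu => ?_)
  rw [enorm_mul, enorm_mul]
  refine mul_le_mul_right (le_of_eq ?_) _
  rw [← ofReal_norm, ← ofReal_norm, norm_cpow_one_div_sub_one hz hu.1, Complex.norm_real,
    Real.norm_of_nonneg (by positivity)]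

/-- On monomials, `∫_0^1 u^(n + 1/z - 1) du = 1/(n + 1/z) = z/(1 + nz)`. -/
theorem polySymbol_eq_integral (p : Polynomial ℂ) {z : ℂ} (hz0 : z ≠ 0)
    (hz : (1 / z).re = 1 / 2) :
    polySymbol p z = ∫ u in Set.Ioo (0 : ℝ) 1, polyKernel p u * (u : ℂ) ^ (1 / z - 1) := by
  induction p using Polynomial.induction_on' with
  | add p q hp hq =>
    rw [polySymbol_add, hp, hq, ← integral_add
      ((isHausdorffKernel_polyKernel p).integrableOn_mul_cpow hz)
      ((isHausdorffKernel_polyKernel q).integrableOn_mul_cpow hz), polyKernel_add]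
    simp only [add_mul]
  | monomial n a =>
    have e : ∫ u in Set.Ioo (0 : ℝ) 1,
        polyKernel (Polynomial.monomial n a) u * (u : ℂ) ^ (1 / z - 1) =
        ∫ u in Set.Ioo (0 : ℝ) 1, a * ((u : ℂ) ^ n * (u : ℂ) ^ (1 / z - 1)) := by
      refine setIntegral_congr_fun measurableSet_Ioo fun u hu => ?_
      simp only [polyKernel, Set.indicator_of_mem hu, Polynomial.eval_monomial, mul_assoc]
    rw [e, integral_const_mul, integral_pow_mul_cpow (by rw [hz]; norm_num), polySymbol_monomial]
    congr 1
    have : (n : ℂ) + 1 / z = (1 + n * z) * z⁻¹ := by field_simp; ring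
    rw [this, one_div, mul_inv, inv_inv, mul_comm]

/-! ### Functional calculus of a normal operator `T` with `1 - T` unitary. -/

section Abstract

variable {H : Type*} [NormedAddCommGroup H] [InnerProductSpace ℂ H] [CompleteSpace H]
  {T : H →L[ℂ] H}

theorem one_sub_mem_unitary (h₁ : star T * T = T + star T) (h₂ : T * star T = T + star T) :
    1 - T ∈ unitary (H →L[ℂ] H) := by
  rw [Unitary.mem_iff, star_sub, star_one]
  constructor
  · have : (1 - star T) * (1 - T) = 1 - T - star T + star T * T := by noncomm_ring
    rw [this, h₁]; abel
  · have : (1 - T) * (1 - star T) = 1 - T - star T + T * star T := by noncomm_ring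
    rw [this, h₂]; abel

theorem norm_one_sub_of_mem_spectrum (hT : 1 - T ∈ unitary (H →L[ℂ] H)) {z : ℂ}
    (hz : z ∈ spectrum ℂ T) : ‖1 - z‖ = 1 := by
  have h : 1 - z ∈ spectrum ℂ (1 - T) := by
    rw [spectrum.mem_iff] at hz ⊢
    rwa [map_sub, map_one, sub_sub_sub_cancel_left, ← neg_sub, IsUnit.neg_iff]
  simpa using spectrum.subset_circle_of_unitary hT h

/-- The circle `|1 - z| = 1` is `|z|² = 2 Re z`; inversion maps it, without `0`, to the line `Re =
1/2`. -/
theorem re_of_mem_spectrum (hT : 1 - T ∈ unitary (H →L[ℂ] H)) {z : ℂ} (hz : z ∈ spectrum ℂ T)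
    (hz0 : z ≠ 0) : 0 < z.re ∧ (1 / z).re = 1 / 2 := by
  have h := norm_one_sub_of_mem_spectrum hT hz
  have hn : 0 < Complex.normSq z := Complex.normSq_pos.mpr hz0
  have h2 : Complex.normSq z = 2 * z.re := by
    have := Complex.normSq_eq_norm_sq (1 - z)
    rw [h, Complex.normSq_apply] at this
    simp only [Complex.sub_re, Complex.one_re, Complex.sub_im, Complex.one_im] at this
    rw [Complex.normSq_apply]
    linarith
  refine ⟨by linarith, ?_⟩
  rw [one_div, Complex.inv_re, h2]
  have : z.re ≠ 0 := by linarith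
  field_simp

theorem continuousOn_cpow_spectrum (hT : 1 - T ∈ unitary (H →L[ℂ] H)) {α : ℂ} (hα : 0 < α.re) :
    ContinuousOn (fun z : ℂ => z ^ α) (spectrum ℂ T) := by
  intro z hz
  refine ContinuousAt.continuousWithinAt ?_
  by_cases hz0 : z = 0
  · subst hz0
    exact (Complex.continuousAt_cpow_zero_of_re_pos hα).comp (f := fun z : ℂ => (z, α))
      (by fun_prop)
  · exact continuousAt_cpow_const (Or.inl (re_of_mem_spectrum hT hz hz0).1)

theorem one_add_natCast_mul_ne_zero (hT : 1 - T ∈ unitary (H →L[ℂ] H)) {z : ℂ}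
    (hz : z ∈ spectrum ℂ T) (n : ℕ) : 1 + n * z ≠ 0 := by
  have hre : 0 ≤ z.re := by
    by_cases hz0 : z = 0
    · simp [hz0]
    · exact (re_of_mem_spectrum hT hz hz0).1.le
  intro h
  have h' := congrArg Complex.re h
  simp only [Complex.add_re, Complex.one_re, Complex.mul_re, Complex.natCast_re,
    Complex.natCast_im, zero_mul, sub_zero, Complex.zero_re] at h'
  have : 0 ≤ (n : ℝ) * z.re := by positivity
  linarith

theorem continuousOn_mul_inv (hT : 1 - T ∈ unitary (H →L[ℂ] H)) (n : ℕ) :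
    ContinuousOn (fun z : ℂ => z * (1 + n * z)⁻¹) (spectrum ℂ T) :=
  continuousOn_id.mul
    (ContinuousOn.inv₀ (by fun_prop) fun _ hz => one_add_natCast_mul_ne_zero hT hz n)

theorem continuousOn_polySymbol (hT : 1 - T ∈ unitary (H →L[ℂ] H)) (p : Polynomial ℂ) :
    ContinuousOn (polySymbol p) (spectrum ℂ T) :=
  continuousOn_finsetSum _ fun n _ => (continuousOn_mul_inv hT n).const_mul _

/-- The hypothesis says `Q (1 + nT) = T`. As `Re z ≥ 0` on the spectrum, `1 + nz` has no zero there,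
so the functional calculus supplies an inverse `R` of `1 + nT` to multiply by on the right. -/
theorem eq_cfc_of_smul_mul_add_eq (hN : IsStarNormal T) (hT : 1 - T ∈ unitary (H →L[ℂ] H))
    {Q : H →L[ℂ] H} {n : ℕ} (h : (n : ℂ) • (Q * T) + Q = T) :
    Q = cfc (fun z : ℂ => z * (1 + n * z)⁻¹) T := by
  have hc : ContinuousOn (fun z : ℂ => (1 + n * z)⁻¹) (spectrum ℂ T) :=
    ContinuousOn.inv₀ (by fun_prop) fun z hz => one_add_natCast_mul_ne_zero hT hz n
  have hc' := continuousOn_mul_inv hT n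
  set R := cfc (fun z : ℂ => (1 + n * z)⁻¹) T with hR
  have hTR : cfc (fun z : ℂ => z * (1 + n * z)⁻¹) T = T * R := by
    rw [cfc_mul (fun z : ℂ => z) _ T continuousOn_id hc, cfc_id' ℂ T]
  have hone : (n : ℂ) • (T * R) + R = 1 := by
    rw [← hTR, hR, ← cfc_const_mul _ _ T hc', ← cfc_add T _ _ (hc'.const_mul _) hc, ← cfc_one ℂ T]
    refine cfc_congr fun z hz => ?_
    have := one_add_natCast_mul_ne_zero hT hz n
    simp only [Pi.one_apply]
    field_simp
    ring
  rw [hTR]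
  calc Q = Q * ((n : ℂ) • (T * R) + R) := by rw [hone, mul_one]
    _ = ((n : ℂ) • (Q * T) + Q) * R := by
        rw [mul_add, add_mul, mul_smul_comm, smul_mul_assoc, mul_assoc]
    _ = T * R := by rw [h]

/-- A linear family of operators that satisfies the resolvent identity on monomials is given by
the functional calculus. -/
theorem eq_cfc_polySymbol (hN : IsStarNormal T) (hT : 1 - T ∈ unitary (H →L[ℂ] H))
    {P : Polynomial ℂ → H →L[ℂ] H} (hadd : ∀ p q, P (p + q) = P p + P q)
    (hmul : ∀ c p, P (Polynomial.C c * p) = c • P p)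
    (hpow : ∀ n : ℕ, (n : ℂ) • (P (Polynomial.X ^ n) * T) + P (Polynomial.X ^ n) = T)
    (p : Polynomial ℂ) : P p = cfc (polySymbol p) T := by
  induction p using Polynomial.induction_on' with
  | add p q hp hq =>
    rw [hadd, hp, hq, ← cfc_add T _ _ (continuousOn_polySymbol hT p) (continuousOn_polySymbol hT q)]
    exact cfc_congr fun z _ => (polySymbol_add p q z).symm
  | monomial n a =>
    rw [← Polynomial.C_mul_X_pow_eq_monomial, hmul, eq_cfc_of_smul_mul_add_eq hN hT (hpow n),
      ← cfc_const_mul _ _ T (continuousOn_mul_inv hT n), Polynomial.C_mul_X_pow_eq_monomial]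
    exact cfc_congr fun z _ => (polySymbol_monomial n a z).symm

/-- The functional calculus is bounded by the supremum over the spectrum, so a function `g` close to
`f` there with `cfc g T` close to `A` bounds `‖cfc f T - A‖`. -/
theorem cfc_eq_of_forall_approx {f : ℂ → ℂ} (hf : ContinuousOn f (spectrum ℂ T)) {A : H →L[ℂ] H} (h : ∀ ε : ℝ, 0 < ε → ∃ g : ℂ → ℂ, ContinuousOn g (spectrum ℂ T) ∧
      (∀ z ∈ spectrum ℂ T, ‖f z - g z‖ ≤ ε) ∧ ‖A - cfc g T‖ ≤ ε) :
    cfc f T = A := by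
  rw [← sub_eq_zero, ← norm_le_zero_iff]
  refine le_of_forall_pos_le_add fun ε hε => ?_
  obtain ⟨g, hg, hfg, hA⟩ := h (ε / 2) (half_pos hε)
  have h1 : ‖cfc f T - cfc g T‖ ≤ ε / 2 := by
    rw [← cfc_sub f g T hf hg]
    exact norm_cfc_le (half_pos hε).le hfg
  have h2 : cfc f T - A = (cfc f T - cfc g T) - (A - cfc g T) := by abel
  rw [h2]
  refine (norm_sub_le _ _).trans ?_
  linarith

theorem pow_eq_normalPow (hN : IsStarNormal T) (n : ℕ) : T ^ n = normalPow T (n : ℂ) := by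
  rw [normalPow]
  simp only [Complex.cpow_natCast]
  rw [cfc_pow_id T n]

theorem normalPow_eq_of_forall_approx (hN : IsStarNormal T) (hT : 1 - T ∈ unitary (H →L[ℂ] H))
    {P : Polynomial ℂ → H →L[ℂ] H} (hadd : ∀ p q, P (p + q) = P p + P q)
    (hmul : ∀ c p, P (Polynomial.C c * p) = c • P p)
    (hpow : ∀ n : ℕ, (n : ℂ) • (P (Polynomial.X ^ n) * T) + P (Polynomial.X ^ n) = T)
    {α : ℂ} (hα : 0 < α.re) {A : H →L[ℂ] H}
    (h : ∀ ε : ℝ, 0 < ε → ∃ p : Polynomial ℂ, ‖A - P p‖ ≤ ε ∧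
      ∀ z : ℂ, z ≠ 0 → (1 / z).re = 1 / 2 → ‖z ^ α - polySymbol p z‖ ≤ ε) :
    normalPow T α = A := by
  refine cfc_eq_of_forall_approx (continuousOn_cpow_spectrum hT hα) fun ε hε => ?_
  obtain ⟨p, hp, hz⟩ := h ε hε
  refine ⟨polySymbol p, continuousOn_polySymbol hT p, fun z hzs => ?_, ?_⟩
  · by_cases hz0 : z = 0
    -- The point `0` may lie in the spectrum but has no `1/z` on the line; both functions vanish
    -- there, since `0 ^ α = 0` for `α ≠ 0`.
    · have hα0 : α ≠ 0 := fun h => by simp [h] at hα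
      simpa [hz0, polySymbol_zero_right, Complex.zero_cpow hα0] using hε.le
    · exact hz z hz0 (re_of_mem_spectrum hT hzs hz0).2
  · rwa [← eq_cfc_polySymbol hN hT hadd hmul hpow p]

end Abstract

/-! ### Hölder means as powers of the Cesàro operator. -/

theorem isStarNormal_cesaroPlus : IsStarNormal cesaroPlus :=
  ⟨star_cesaroPlus_mul_self.trans cesaroPlus_mul_star_self.symm⟩

theorem holderKernel_of_notMem (α : ℂ) : ∀ u, u ∉ Set.Ioo (0 : ℝ) 1 → holderKernel α u = 0 :=
  fun _ hu => Set.indicator_of_notMem hu _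

/-- One polynomial serves for both estimates: operator and symbol are linear in the kernel, and the
difference of the two kernels has weighted norm at most `ε`. -/
theorem exists_norm_holderMeanPlus_sub_polyPlus_le {α : ℂ} (hα : 0 < α.re) {ε : ℝ} (hε : 0 < ε) :
    ∃ p : Polynomial ℂ, ‖holderMeanPlus α hα - polyPlus p‖ ≤ ε ∧
      ∀ z : ℂ, z ≠ 0 → (1 / z).re = 1 / 2 → ‖z ^ α - polySymbol p z‖ ≤ ε := by
  have hK := isHausdorffKernel_holderKernel hα
  obtain ⟨p, hp⟩ := exists_wt_sub_polyKernel_le hK (holderKernel_of_notMem α)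
    (ENNReal.ofReal_pos.mpr hε).ne'
  have hP := isHausdorffKernel_polyKernel p
  have hp' : (Hausdorff.wt fun u => holderKernel α u - polyKernel p u).toReal ≤ ε :=
    ENNReal.toReal_le_of_le_ofReal hε.le hp
  refine ⟨p, ?_, fun z hz0 hz => ?_⟩
  · have h0 : ∀ u < 0, holderKernel α u - polyKernel p u = 0 := fun u hu => by
      rw [holderKernel_of_neg α u hu, polyKernel_of_neg p u hu, sub_zero]
    have e : holderMeanPlus α hα - polyPlus p =
        restrictPlus (hausdorff _ (hK.sub hP)) (hausdorff_mem_L2Plus _ h0) := by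
      simp only [hausdorff_sub hK hP]
      rfl
    rw [e]
    exact (norm_restrictPlus_le _ _).trans ((norm_hausdorff_le _).trans hp')
  -- The Mellin transform of the Hölder kernel at `s = 1/z` is `(1/s)^α = z^α`.
  · have e : z ^ α - polySymbol p z = ∫ u in Set.Ioo (0 : ℝ) 1,
        (holderKernel α u - polyKernel p u) * (u : ℂ) ^ (1 / z - 1) := by
      simp only [sub_mul]
      rw [integral_sub (hK.integrableOn_mul_cpow hz) (hP.integrableOn_mul_cpow hz),
        ← polySymbol_eq_integral p hz0 hz,
        integral_holderKernel_mul_cpow hα (by rw [hz]; norm_num), one_div_one_div]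
    rw [e]
    exact (norm_integral_mul_cpow_le (hK.sub hP) hz).trans hp'

theorem normalPow_cesaroPlus (α : ℂ) (hα : 0 < α.re) :
    normalPow cesaroPlus α = holderMeanPlus α hα :=
  normalPow_eq_of_forall_approx isStarNormal_cesaroPlus
    (one_sub_mem_unitary star_cesaroPlus_mul_self cesaroPlus_mul_star_self)
    polyPlus_add polyPlus_C_mul polyPlus_X_pow_mul_cesaroPlus hα
    fun _ hε => exists_norm_holderMeanPlus_sub_polyPlus_le hα hε

/-- The Cesàro operator `𝒞₊` in `L²(ℝ₊)` is normal, its spectrum lies in the domain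
`{Re z > 0} ∪ {0}` of the branch `z ↦ z ^ α` (with `1 ^ α = 1`, `0 ^ α = 0`), and for `Re α > 0`
this branch is continuous on the spectrum and the power `(𝒞₊) ^ α`, in the sense of the functional
calculus of normal operators, is the restricted Hölder mean `H_{α+}`; for integers `n ≥ 1` this
gives the `n`-th iterate of `𝒞₊`. -/
theorem mainTheorem7 :
    IsStarNormal cesaroPlus ∧
    spectrum ℂ cesaroPlus ⊆ {z : ℂ | 0 < z.re} ∪ {0} ∧
    (∀ (α : ℂ) (hα : 0 < α.re),
      ContinuousOn (fun z : ℂ => z ^ α) (spectrum ℂ cesaroPlus) ∧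
      normalPow cesaroPlus α = holderMeanPlus α hα) ∧
    (∀ (n : ℕ) (hn : 0 < (n : ℂ).re), cesaroPlus ^ n = holderMeanPlus (n : ℂ) hn) := by
  have hT := one_sub_mem_unitary star_cesaroPlus_mul_self cesaroPlus_mul_star_self
  refine ⟨isStarNormal_cesaroPlus, fun z hz => ?_, fun α hα =>
    ⟨continuousOn_cpow_spectrum hT hα, normalPow_cesaroPlus α hα⟩, fun n hn => ?_⟩
  · by_cases hz0 : z = 0
    · exact Or.inr hz0
    · exact Or.inl (re_of_mem_spectrum hT hz hz0).1
  · exact (pow_eq_normalPow isStarNormal_cesaroPlus n).trans (normalPow_cesaroPlus n hn)
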